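/- Let $(M,g)$ be a compact smooth Riemannian manifold with boundary, of dimension $n\ge 1$, each of whose connected components meets $\partial M$ (for instance $M$ connected with $\partial M\neq\emptyset$), let $\sigma_g$ be its Riemannian measure, and let $1<p<\infty$ and $f\in L^1(M)$. Notation. $C_0^\infty(M)$ is the set of smooth functions with compact support in $M\setminus\partial M$; local spaces and weak gradients refer to $M\setminus\partial M$, all gradients, scalar products and norms are those of $g$, and $W_0^{1,p}(M)$ is the closure of $C_0^\infty(M)$ in the norm $\|u\|_p+\|\nabla u\|_p$. For $k>0$ let $T_k(s)=\max(-k,\min(s,k))$. Let $\tau_0^{1,p}(M)$ be the set of measurable $u:M\to\mathbb R$ such that for every $k>0$: $T_k(u)\in W^{1,1}_{loc}(M)$, $|\nabla T_k(u)|\in L^p(M)$, and there is a sequence $(\theta_m)\subset C_0^\infty(M)$ with $\theta_m\to T_k(u)$ in $L^1_{loc}(M)$ and $\nabla\theta_m\to\nabla T_k(u)$ in $L^p(M)$. For such $u$, $\nabla u$ denotes the (a.e. unique) measurable vector field with $\nabla T_k(u)=\nabla u\,1_{\{|u|<k\}}$ a.e. for all $k>0$. A function $u\in\tau_0^{1,p}(M)$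 is an entropy solution of $-\Delta_p u=f$ in $M$, $u=0$ on $\partial M$, if $$\int_{\{|u-\varphi|<k\}}|\nabla u|^{p-2}\langle\nabla u,\nabla (u-\varphi)\rangle\,d\sigma_g=\int_M T_k(u-\varphi)\,f\,d\sigma_g$$ for all $\varphi\in L^\infty(M)\cap W_0^{1,p}(M)$ and all $k>0$. Theorem. If $u_1,u_2\in\tau_0^{1,p}(M)$ are entropy solutions of $-\Delta_p u=f$ in $M$, $u=0$ on $\partial M$ (with the same $f$), then $u_1=u_2$ almost everywhere on $M$. -/

import Mathlib

open Set Filter Topology MeasureTheory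
open scoped Manifold ContDiff ENNReal

noncomputable section EntropySolutions

/-- The model space `ℝⁿ`. -/
abbrev RSpace (n : ℕ) : Type := EuclideanSpace ℝ (Fin n)

variable {n : ℕ} [NeZero n] {M : Type*} [TopologicalSpace M]
  [ChartedSpace (EuclideanHalfSpace n) M] [IsManifold (𝓡∂ n) ∞ M]

/-- A smooth Riemannian metric on the smooth manifold with boundary `M` of dimension `n`. -/
abbrev SmoothMetric (n : ℕ) [NeZero n] (M : Type*) [TopologicalSpace M]
    [ChartedSpace (EuclideanHalfSpace n) M] [IsManifold (𝓡∂ n) ∞ M] :=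
  Bundle.ContMDiffRiemannianMetric (𝓡∂ n) ∞ (RSpace n) (fun x : M => TangentSpace (𝓡∂ n) x)

/-- Vector fields on `M`, with no regularity required. -/
abbrev VField (n : ℕ) [NeZero n] (M : Type*) [TopologicalSpace M]
    [ChartedSpace (EuclideanHalfSpace n) M] :=
  (x : M) → TangentSpace (𝓡∂ n) x

/-- The coordinate vector field in direction `e ∈ ℝⁿ` of the chart around `c`, at the point of `M`
with coordinates `z`, that is `d(φ_c⁻¹)_z (e)`. -/
def coordVector (c : M) (z e : RSpace n) : TangentSpace (𝓡∂ n) ((extChartAt (𝓡∂ n) c).symm z) :=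
  mfderivWithin 𝓘(ℝ, RSpace n) (𝓡∂ n) (extChartAt (𝓡∂ n) c).symm (range (𝓡∂ n)) z e

/-- The matrix `(g_ij)` of the metric in the coordinates of the chart around `c`. -/
def gramMatrix (g : SmoothMetric n M) (c : M) (z : RSpace n) : Matrix (Fin n) (Fin n) ℝ :=
  fun i j => g.inner ((extChartAt (𝓡∂ n) c).symm z)
    (coordVector c z (EuclideanSpace.basisFun (Fin n) ℝ i))
    (coordVector c z (EuclideanSpace.basisFun (Fin n) ℝ j))

/-- The measure `√(det g_ij) dz` on the domain of the chart around `c`, seen as a measure on `M`. -/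
def chartVolume [MeasurableSpace M] (g : SmoothMetric n M) (c : M) : Measure M :=
  ((volume.restrict (extChartAt (𝓡∂ n) c).target).withDensity
    (fun z => ENNReal.ofReal (Real.sqrt (gramMatrix g c z).det))).map (extChartAt (𝓡∂ n) c).symm

/-- A smooth partition of unity subordinate to the charts of `M`. -/
def chartPartition (n : ℕ) [NeZero n] (M : Type*) [TopologicalSpace M]
    [ChartedSpace (EuclideanHalfSpace n) M] [IsManifold (𝓡∂ n) ∞ M] [T2Space M] [CompactSpace M] :
    SmoothPartitionOfUnity M (𝓡∂ n) M univ :=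
  (SmoothPartitionOfUnity.exists_isSubordinate_chartAt_source (𝓡∂ n) M).choose

/-- The Riemannian measure `σ_g`: `∫ f dσ_g = ∑_c ∫ η_c √(det g) f dz`, where `(η_c)` is a smooth
partition of unity subordinate to the charts. -/
def riemVolume [T2Space M] [CompactSpace M] [MeasurableSpace M] (g : SmoothMetric n M) :
    Measure M :=
  Measure.sum (fun c : M =>
    (chartVolume g c).withDensity (fun x => ENNReal.ofReal (chartPartition n M c x)))

/-- The length `|V|_g` of a vector field. -/
def fieldNorm (g : SmoothMetric n M) (V : VField n M) (x : M) : ℝ :=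
  Real.sqrt (g.inner x (V x) (V x))

/-- The scalar product of the metric at `x`, as a bilinear form. -/
def metricForm (g : SmoothMetric n M) (x : M) :
    LinearMap.BilinForm ℝ (TangentSpace (𝓡∂ n) x) :=
  LinearMap.mk₂ ℝ (fun v w => g.inner x v w) (by simp) (by simp) (by simp) (by simp)

theorem metricForm_nondegenerate (g : SmoothMetric n M) (x : M) :
    (metricForm g x).Nondegenerate := by
  have key : ∀ v : TangentSpace (𝓡∂ n) x, metricForm g x v v = 0 → v = 0 := by
    intro v h
    by_contra hv
    exact (g.pos x v hv).ne' h
  exact ⟨fun v h => key v (h v), fun v h => key v (h v)⟩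

instance instFiniteDimensionalTangent (x : M) :
    FiniteDimensional ℝ (TangentSpace (𝓡∂ n) x) :=
  inferInstanceAs (FiniteDimensional ℝ (RSpace n))

/-- The Riemannian gradient of a differentiable function, that is the vector field with
`g (∇φ, v) = dφ (v)`. -/
def grad (g : SmoothMetric n M) (φ : M → ℝ) : VField n M := fun x =>
  ((metricForm g x).toDual (metricForm_nondegenerate g x)).symm
    (mfderiv (𝓡∂ n) 𝓘(ℝ, ℝ) φ x).toLinearMap

theorem inner_grad (g : SmoothMetric n M) (φ : M → ℝ) (x : M) (v : TangentSpace (𝓡∂ n) x) :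
    g.inner x (grad g φ x) v = mfderiv (𝓡∂ n) 𝓘(ℝ, ℝ) φ x v :=
  LinearMap.BilinForm.apply_toDual_symm_apply (B := metricForm g x)
    (hB := metricForm_nondegenerate g x) _ v

/-- `φ` is a test function: smooth on `M`, with compact support in the interior `M \ ∂M`. -/
def IsTestFunction (n : ℕ) [NeZero n] {M : Type*} [TopologicalSpace M]
    [ChartedSpace (EuclideanHalfSpace n) M] (φ : M → ℝ) : Prop :=
  ContMDiff (𝓡∂ n) 𝓘(ℝ, ℝ) ∞ φ ∧ HasCompactSupport φ ∧ tsupport φ ⊆ (𝓡∂ n).interior M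

/-- `u` belongs to `W^{1,1}_loc` (of the interior of `M`) and `V` is its weak gradient: in each
chart, `u` and the components `g(V, ∂_e)` are locally integrable for Lebesgue measure on the open
set of the coordinates of interior points, and `g(V, ∂_e)` is the weak derivative `∂_e u`. -/
def HasWeakGradient (g : SmoothMetric n M) (u : M → ℝ) (V : VField n M) : Prop :=
  ∀ c : M,
    LocallyIntegrableOn (fun z => u ((extChartAt (𝓡∂ n) c).symm z))
      (interior (extChartAt (𝓡∂ n) c).target) volume ∧
    ∀ e : RSpace n,
      LocallyIntegrableOn
        (fun z => g.inner ((extChartAt (𝓡∂ n) c).symm z) (V ((extChartAt (𝓡∂ n) c).symm z))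
          (coordVector c z e))
        (interior (extChartAt (𝓡∂ n) c).target) volume ∧
      ∀ ψ : RSpace n → ℝ, ContDiff ℝ ∞ ψ → HasCompactSupport ψ →
        tsupport ψ ⊆ interior (extChartAt (𝓡∂ n) c).target →
        ∫ z, u ((extChartAt (𝓡∂ n) c).symm z) * fderiv ℝ ψ z e =
          - ∫ z, g.inner ((extChartAt (𝓡∂ n) c).symm z) (V ((extChartAt (𝓡∂ n) c).symm z))
              (coordVector c z e) * ψ z

/-- The truncation `T_k(s) = s` for `|s| ≤ k`, `T_k(s) = k sign s` for `|s| > k`. -/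
def trunc (k s : ℝ) : ℝ := max (-k) (min s k)

/-- The vector field `V 1_{|w| < k}`. -/
def cutField (w : M → ℝ) (k : ℝ) (V : VField n M) : VField n M := fun x =>
  if |w x| < k then V x else 0

variable [T2Space M] [CompactSpace M] [MeasurableSpace M]

/-- `φ ∈ W_0^{1,p}(M)` with weak gradient `Φ`: the function and its weak gradient are in `L^p`, and
`φ` is the limit of test functions for the norm `‖u‖_p + ‖∇u‖_p`. -/
structure MemW0 (g : SmoothMetric n M) (p : ℝ) (φ : M → ℝ) (Φ : VField n M) : Prop where
  memLp : MemLp φ (ENNReal.ofReal p) (riemVolume g)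
  hasWeakGradient : HasWeakGradient g φ Φ
  memLp_grad : MemLp (fieldNorm g Φ) (ENNReal.ofReal p) (riemVolume g)
  approx : ∃ θ : ℕ → M → ℝ, (∀ m, IsTestFunction n (θ m)) ∧
    Tendsto (fun m => eLpNorm (θ m - φ) (ENNReal.ofReal p) (riemVolume g)) atTop (𝓝 0) ∧
    Tendsto (fun m => eLpNorm (fieldNorm g (grad g (θ m) - Φ)) (ENNReal.ofReal p) (riemVolume g))
      atTop (𝓝 0)

/-- The space `τ^{1,p}(M)`: measurable functions `u` such that for every `k > 0` the truncation
`T_k(u)` is in `W^{1,1}_loc` with `|∇ T_k(u)| ∈ L^p(M)`. -/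
structure MemTau (g : SmoothMetric n M) (p : ℝ) (u : M → ℝ) : Prop where
  aemeasurable : AEMeasurable u (riemVolume g)
  trunc_grad : ∀ k : ℝ, 0 < k → ∃ W : VField n M,
    HasWeakGradient g (fun x => trunc k (u x)) W ∧
    MemLp (fieldNorm g W) (ENNReal.ofReal p) (riemVolume g)

/-- The space `τ_0^{1,p}(M)`: functions `u ∈ τ^{1,p}(M)` such that for every `k > 0` there are test
functions `θ_m` with `θ_m → T_k(u)` in `L^1_loc` and `∇θ_m → ∇T_k(u)` in `L^p(M)`. -/
structure MemTau0 (g : SmoothMetric n M) (p : ℝ) (u : M → ℝ) : Prop extends MemTau g p u where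
  approx : ∀ k : ℝ, 0 < k → ∃ W : VField n M,
    HasWeakGradient g (fun x => trunc k (u x)) W ∧
    ∃ θ : ℕ → M → ℝ, (∀ m, IsTestFunction n (θ m)) ∧
      (∀ K : Set M, IsCompact K → K ⊆ (𝓡∂ n).interior M →
        Tendsto (fun m => ∫⁻ x in K, ‖θ m x - trunc k (u x)‖ₑ ∂(riemVolume g)) atTop (𝓝 0)) ∧
      Tendsto (fun m => eLpNorm (fieldNorm g (grad g (θ m) - W)) (ENNReal.ofReal p) (riemVolume g))
        atTop (𝓝 0)

/-- `V` is the generalized gradient of `u`: `∇ T_k(u) = V 1_{|u| < k}` for every `k > 0`. -/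
def IsGenGradient (g : SmoothMetric n M) (u : M → ℝ) (V : VField n M) : Prop :=
  ∀ k : ℝ, 0 < k → HasWeakGradient g (fun x => trunc k (u x)) (cutField u k V)

/-- `u ∈ τ_0^{1,p}(M)` is an entropy solution of `-Δ_p u = f` in `M`, `u = 0` on `∂M`: with `∇u` the
generalized gradient of `u` (unique up to a null set), for all `φ ∈ L^∞(M) ∩ W_0^{1,p}(M)`, `k > 0`,
`∫_{|u-φ|<k} |∇u|^{p-2} g(∇u, ∇u - ∇φ) dσ_g = ∫_M T_k(u-φ) f dσ_g`. -/
def IsEntropySolution (g : SmoothMetric n M) (p : ℝ) (f u : M → ℝ) : Prop :=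
  MemTau0 g p u ∧ ∃ V : VField n M, IsGenGradient g u V ∧
    ∀ (φ : M → ℝ) (Φ : VField n M), MemW0 g p φ Φ → MemLp φ ∞ (riemVolume g) →
      ∀ k : ℝ, 0 < k →
        ∫ x in {x | |u x - φ x| < k},
            fieldNorm g V x ^ (p - 2) * g.inner x (V x) (V x - Φ x) ∂(riemVolume g) =
          ∫ x, trunc k (u x - φ x) * f x ∂(riemVolume g)

end EntropySolutions

/-!
Testing the equation of `u₁` with `T_h(u₂)` and that of `u₂` with `T_h(u₁)` and adding, the
right-hand side tends to zero as `h → ∞`, since `T_k` is odd and `f` is integrable. On the set where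
neither function is truncated, the left-hand side is the integral of
`⟨|∇u₁|^{p-2}∇u₁ - |∇u₂|^{p-2}∇u₂, ∇u₁ - ∇u₂⟩ ≥ 0`; the rest is bounded below by minus the energies
of `u₁` and `u₂` on the strips `{h ≤ |u| < h + k}` and `{h - k ≤ |u| < h}` (`monotonicityGap_le`).
Testing the equation of `u` with `T_h(u)` shows that these energies tend to zero
(`EntropyFormulation.tendsto_integral_stripEnergy`). Hence `∇u₁ = ∇u₂` almost everywhere
(`EntropyFormulation.ae_gradient_eq`).

Let now `S` be a smooth bounded function with compactly supported derivative that vanishes only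
at `0`. As the gradients agree, `∇ S(T_h(u₁) - T_h(u₂))` is carried by the strips where only one of
the two functions is truncated, so it tends to zero in `L^p` (`tendsto_eLpNorm_diff`). These
functions are limits of test functions, so a Poincaré inequality gives `S(u₁ - u₂) = 0`, that is
`u₁ = u₂`.

Only a qualitative Poincaré inequality is needed (`ae_tendsto_zero_of_summable_grad`): a sequence of
test functions with gradients summable in `L¹` tends to zero almost everywhere. In a ball of
coordinates the increments of such a sequence in any direction tend to zero almost everywhere, so by
Fubini the sequence tends to zero almost everywhere or almost nowhere
(`measure_tendsto_zero_dichotomy`). Around a boundary point, the extension by zero beyond the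
boundary selects the first alternative. The points near which the sequence tends to zero therefore form a
clopen set containing the boundary, which is all of `M` as every component meets the boundary.

That truncations of `u ∈ τ_0^{1,p}` are admissible (`MemTau0.memW0_trunc`) follows by composing the
approximating test functions with a smooth bounded truncation. The chain rule is used for test
functions only, and independence of the measure from the charts is used for null sets only.
-/

set_option linter.unusedSectionVars false

/-! ### The Gram matrix in a chart -/

section Charts

variable {n : ℕ} [NeZero n] {M : Type*} [TopologicalSpace M]
  [ChartedSpace (EuclideanHalfSpace n) M] [IsManifold (𝓡∂ n) ∞ M]

theorem coordVector_add (c : M) (z e e' : RSpace n) :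
    coordVector c z (e + e') = coordVector c z e + coordVector c z e' :=
  map_add _ _ _

theorem coordVector_smul (c : M) (z : RSpace n) (a : ℝ) (e : RSpace n) :
    coordVector c z (a • e) = a • coordVector c z e :=
  map_smul _ _ _

/-- On the chart domain, the coordinate vectors are given by the trivialization of the tangent
bundle. -/
theorem coordVector_eq_symmL (c : M) {z : RSpace n} (hz : z ∈ (extChartAt (𝓡∂ n) c).target)
    (e : RSpace n) :
    coordVector c z e = (trivializationAt (RSpace n) (TangentSpace (𝓡∂ n)) c).symmL ℝ
      ((extChartAt (𝓡∂ n) c).symm z) e := by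
  have hx : (extChartAt (𝓡∂ n) c).symm z ∈ (chartAt (EuclideanHalfSpace n) c).source := by
    rw [← extChartAt_source (𝓡∂ n)]; exact (extChartAt (𝓡∂ n) c).map_target hz
  have h := TangentBundle.symmL_trivializationAt (I := 𝓡∂ n) hx
  rw [(extChartAt (𝓡∂ n) c).right_inv hz] at h
  rw [h]; rfl

theorem coordVector_surjective (c : M) {z : RSpace n} (hz : z ∈ (extChartAt (𝓡∂ n) c).target)
    (v : TangentSpace (𝓡∂ n) ((extChartAt (𝓡∂ n) c).symm z)) : ∃ e, coordVector c z e = v := by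
  have hx : (extChartAt (𝓡∂ n) c).symm z ∈
      (trivializationAt (RSpace n) (TangentSpace (𝓡∂ n) (M := M)) c).baseSet := by
    rw [TangentBundle.trivializationAt_baseSet, ← extChartAt_source (𝓡∂ n)]
    exact (extChartAt (𝓡∂ n) c).map_target hz
  refine ⟨(trivializationAt (RSpace n) (TangentSpace (𝓡∂ n)) c).continuousLinearMapAt ℝ _ v, ?_⟩
  rw [coordVector_eq_symmL c hz]
  exact Bundle.Trivialization.symmL_continuousLinearMapAt _ hx v

theorem coordVector_injective (c : M) {z : RSpace n} (hz : z ∈ (extChartAt (𝓡∂ n) c).target)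
    {e : RSpace n} (h : coordVector c z e = 0) : e = 0 := by
  have hx : (extChartAt (𝓡∂ n) c).symm z ∈
      (trivializationAt (RSpace n) (TangentSpace (𝓡∂ n) (M := M)) c).baseSet := by
    rw [TangentBundle.trivializationAt_baseSet, ← extChartAt_source (𝓡∂ n)]
    exact (extChartAt (𝓡∂ n) c).map_target hz
  rw [coordVector_eq_symmL c hz] at h
  have := Bundle.Trivialization.continuousLinearMapAt_symmL (R := ℝ) _ hx e
  rw [h, map_zero] at this
  exact this.symm

theorem continuousOn_inner_coordVector (g : SmoothMetric n M) (c : M) (e e' : RSpace n) :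
    ContinuousOn (fun z => g.inner ((extChartAt (𝓡∂ n) c).symm z)
      (coordVector c z e) (coordVector c z e')) (extChartAt (𝓡∂ n) c).target := by
  let t := trivializationAt (RSpace n) (TangentSpace (𝓡∂ n) (M := M)) c
  have hb : ContinuousOn (extChartAt (𝓡∂ n) c).symm (extChartAt (𝓡∂ n) c).target :=
    continuousOn_extChartAt_symm c
  have hmem : ∀ z ∈ (extChartAt (𝓡∂ n) c).target, (extChartAt (𝓡∂ n) c).symm z ∈ t.baseSet := by
    intro z hz
    rw [TangentBundle.trivializationAt_baseSet, ← extChartAt_source (𝓡∂ n)]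
    exact (extChartAt (𝓡∂ n) c).map_target hz
  have hsec : ∀ e : RSpace n, ContinuousOn (fun z => Bundle.TotalSpace.mk' (RSpace n)
      (E := TangentSpace (𝓡∂ n)) ((extChartAt (𝓡∂ n) c).symm z) (coordVector c z e))
      (extChartAt (𝓡∂ n) c).target := by
    intro e
    have h1 : ContinuousOn (fun z => t.toOpenPartialHomeomorph.symm
        ((extChartAt (𝓡∂ n) c).symm z, e)) (extChartAt (𝓡∂ n) c).target := by
      refine t.continuousOn_invFun.comp (hb.prodMk continuousOn_const) ?_
      intro z hz
      exact t.mem_target.2 (hmem z hz)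
    refine h1.congr ?_
    intro z hz
    dsimp only
    rw [coordVector_eq_symmL c hz]
    refine (congrArg _ (t.symmL_apply (R := ℝ) (hmem z hz) e)).trans ?_
    exact t.mk_symm (hmem z hz) e
  intro z hz
  have hg := g.contMDiff.continuous.continuousAt.comp_continuousWithinAt (hb z hz)
  have := hg.clm_bundle_apply₂ (F₁ := RSpace n) (F₂ := RSpace n) (hsec e z hz) (hsec e' z hz)
  simp only [FiberBundle.continuousWithinAt_totalSpace] at this
  exact this.2

theorem continuousOn_gramMatrix (g : SmoothMetric n M) (c : M) :
    ContinuousOn (gramMatrix g c) (extChartAt (𝓡∂ n) c).target :=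
  continuousOn_pi.2 fun _ => continuousOn_pi.2 fun _ => continuousOn_inner_coordVector g c _ _

theorem coordVector_sum (c : M) (z : RSpace n) (a : Fin n → ℝ) :
    coordVector c z (∑ i, a i • EuclideanSpace.basisFun (Fin n) ℝ i) =
      ∑ i, a i • coordVector c z (EuclideanSpace.basisFun (Fin n) ℝ i) := by
  have h := map_sum (IsLinearMap.mk' (coordVector c z)
    ⟨coordVector_add c z, coordVector_smul c z⟩)
    (fun i => a i • EuclideanSpace.basisFun (Fin n) ℝ i) Finset.univ
  simpa only [IsLinearMap.mk'_apply, coordVector_smul] using h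

theorem gramMatrix_posDef (g : SmoothMetric n M) (c : M) {z : RSpace n}
    (hz : z ∈ (extChartAt (𝓡∂ n) c).target) : (gramMatrix g c z).PosDef := by
  refine Matrix.PosDef.of_dotProduct_mulVec_pos ?_ ?_
  · ext i j
    exact g.symm _ _ _
  · intro a ha
    have h : star a ⬝ᵥ (gramMatrix g c z).mulVec a = g.inner ((extChartAt (𝓡∂ n) c).symm z)
        (coordVector c z (∑ i, a i • EuclideanSpace.basisFun (Fin n) ℝ i))
        (coordVector c z (∑ i, a i • EuclideanSpace.basisFun (Fin n) ℝ i)) := by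
      rw [coordVector_sum]
      simp only [map_sum, map_smul, sum_apply, smul_apply,
        dotProduct, Matrix.mulVec, gramMatrix, smul_eq_mul, Finset.mul_sum, star_trivial]
      refine Finset.sum_congr rfl fun i _ => Finset.sum_congr rfl fun j _ => ?_
      rw [g.symm]
      ring
    rw [h]
    refine g.pos _ _ fun h0 => ha ?_
    have := coordVector_injective c hz h0
    ext i
    have h2 := congrArg (fun v : RSpace n => v i) this
    simpa [Finset.sum_apply, EuclideanSpace.basisFun_apply, Pi.single_apply] using h2

theorem gramMatrix_det_pos (g : SmoothMetric n M) (c : M) {z : RSpace n}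
    (hz : z ∈ (extChartAt (𝓡∂ n) c).target) : 0 < (gramMatrix g c z).det :=
  (gramMatrix_posDef g c hz).det_pos

theorem continuousOn_sqrt_det_gramMatrix (g : SmoothMetric n M) (c : M) :
    ContinuousOn (fun z => Real.sqrt (gramMatrix g c z).det) (extChartAt (𝓡∂ n) c).target :=
  Real.continuous_sqrt.comp_continuousOn
    ((Continuous.matrix_det continuous_id).comp_continuousOn (continuousOn_gramMatrix g c))

end Charts

/-! ### The Riemannian measure in charts -/

section ChartMeasure

variable {n : ℕ} [NeZero n] {M : Type*} [TopologicalSpace M]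
  [ChartedSpace (EuclideanHalfSpace n) M] [IsManifold (𝓡∂ n) ∞ M]

theorem measurableSet_extChartAt_target (c : M) :
    MeasurableSet (extChartAt (𝓡∂ n) c).target := by
  rw [extChartAt_target]
  exact ((chartAt _ c).open_target.preimage (𝓡∂ n).continuous_symm).measurableSet.inter
    (𝓡∂ n).isClosed_range.measurableSet

/-- Being an interior point can be read in any chart. -/
theorem mem_interior_iff_of_mem_source (c : M) {x : M} (hx : x ∈ (extChartAt (𝓡∂ n) c).source) :
    x ∈ (𝓡∂ n).interior M ↔ extChartAt (𝓡∂ n) c x ∈ interior (extChartAt (𝓡∂ n) c).target :=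
  (𝓡∂ n).isInteriorPoint_iff_of_mem_atlas (n := ∞) (by simp) (chart_mem_atlas _ c)
    (by rwa [extChartAt_source] at hx)

theorem symm_mem_interior_iff (c : M) {z : RSpace n} (hz : z ∈ (extChartAt (𝓡∂ n) c).target) :
    (extChartAt (𝓡∂ n) c).symm z ∈ (𝓡∂ n).interior M ↔
      z ∈ interior (extChartAt (𝓡∂ n) c).target := by
  rw [mem_interior_iff_of_mem_source c ((extChartAt (𝓡∂ n) c).map_target hz),
    (extChartAt (𝓡∂ n) c).right_inv hz]

/-- A point of the chart domain is interior as soon as it is interior to the half-space. -/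
theorem mem_interior_target_of_mem_interior_range (c : M) {z : RSpace n}
    (hz : z ∈ (extChartAt (𝓡∂ n) c).target) (h : z ∈ interior (range (𝓡∂ n))) :
    z ∈ interior (extChartAt (𝓡∂ n) c).target := by
  rw [extChartAt_target, interior_inter]
  rw [extChartAt_target] at hz
  refine ⟨?_, h⟩
  rw [((chartAt _ c).open_target.preimage (𝓡∂ n).continuous_symm).interior_eq]
  exact hz.1

/-- In coordinates, the boundary lies in the frontier of the half-space, a null set by convexity. -/
theorem ae_mem_interior_target (c : M) :
    ∀ᵐ z ∂(volume.restrict (extChartAt (𝓡∂ n) c).target),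
      z ∈ interior (extChartAt (𝓡∂ n) c).target := by
  rw [ae_restrict_iff' (measurableSet_extChartAt_target c)]
  have h : ∀ᵐ z : RSpace n, z ∉ frontier (range (𝓡∂ n)) := by
    have := ((𝓡∂ n).convex_range).addHaar_frontier (μ := (volume : Measure (RSpace n)))
    exact measure_eq_zero_iff_ae_notMem.1 this
  filter_upwards [h] with z hz hzt
  refine mem_interior_target_of_mem_interior_range c hzt ?_
  rw [frontier, (𝓡∂ n).isClosed_range.closure_eq, Set.mem_sdiff, not_and, not_not] at hz
  exact hz (extChartAt_target_subset_range c hzt)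

theorem restrict_interior_extChartAt_target (c : M) :
    volume.restrict (interior (extChartAt (𝓡∂ n) c).target) =
      volume.restrict (extChartAt (𝓡∂ n) c).target := by
  refine Measure.restrict_congr_set ?_
  have := (ae_restrict_iff' (measurableSet_extChartAt_target c)).1 (ae_mem_interior_target (n := n) c)
  filter_upwards [this] with z hz
  exact propext ⟨fun h => interior_subset h, fun h => hz h⟩

variable [T2Space M] [CompactSpace M] [MeasurableSpace M] [BorelSpace M]

theorem measurableSet_extChartAt_source (c : M) :
    MeasurableSet (extChartAt (𝓡∂ n) c).source :=
  (isOpen_extChartAt_source c).measurableSet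

theorem aemeasurable_extChartAt_symm (g : SmoothMetric n M) (c : M) :
    AEMeasurable (extChartAt (𝓡∂ n) c).symm
      ((volume.restrict (extChartAt (𝓡∂ n) c).target).withDensity
        (fun z => ENNReal.ofReal (Real.sqrt (gramMatrix g c z).det))) :=
  ((continuousOn_extChartAt_symm c).aemeasurable
    (measurableSet_extChartAt_target c)).mono_ac (withDensity_absolutelyContinuous _ _)

theorem aemeasurable_chart_density (g : SmoothMetric n M) (c : M) :
    AEMeasurable (fun z => ENNReal.ofReal (Real.sqrt (gramMatrix g c z).det))
      (volume.restrict (extChartAt (𝓡∂ n) c).target) :=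
  ((continuousOn_sqrt_det_gramMatrix g c).aemeasurable
    (measurableSet_extChartAt_target c)).ennreal_ofReal

theorem chartVolume_ae_mem_source (g : SmoothMetric n M) (c : M) :
    ∀ᵐ x ∂(chartVolume g c), x ∈ (extChartAt (𝓡∂ n) c).source := by
  refine (ae_map_iff (aemeasurable_extChartAt_symm g c)
    (measurableSet_extChartAt_source c)).2 ?_
  refine (withDensity_absolutelyContinuous _ _).ae_le ?_
  exact (ae_restrict_mem (measurableSet_extChartAt_target c)).mono
    fun z hz => (extChartAt (𝓡∂ n) c).map_target hz

theorem aemeasurable_extChartAt (g : SmoothMetric n M) (c : M) :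
    AEMeasurable (extChartAt (𝓡∂ n) c) (chartVolume g c) := by
  rw [← Measure.restrict_eq_self_of_ae_mem (chartVolume_ae_mem_source g c)]
  exact (continuousOn_extChartAt c).aemeasurable (measurableSet_extChartAt_source c)

theorem map_extChartAt_chartVolume_ac (g : SmoothMetric n M) (c : M) :
    (chartVolume g c).map (extChartAt (𝓡∂ n) c) ≪
      volume.restrict (extChartAt (𝓡∂ n) c).target := by
  have h := aemeasurable_extChartAt g c
  have h' := aemeasurable_extChartAt_symm g c
  rw [chartVolume] at h ⊢
  rw [AEMeasurable.map_map_of_aemeasurable h h']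
  have : (extChartAt (𝓡∂ n) c) ∘ (extChartAt (𝓡∂ n) c).symm
      =ᵐ[(volume.restrict (extChartAt (𝓡∂ n) c).target).withDensity
        (fun z => ENNReal.ofReal (Real.sqrt (gramMatrix g c z).det))] id := by
    refine (withDensity_absolutelyContinuous _ _).ae_le ?_
    exact (ae_restrict_mem (measurableSet_extChartAt_target c)).mono
      fun z hz => (extChartAt (𝓡∂ n) c).right_inv hz
  rw [Measure.map_congr this, Measure.map_id]
  exact withDensity_absolutelyContinuous _ _

/-- A property that holds almost everywhere in the coordinates of a chart holds almost everywhere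
for the chart volume. -/
theorem ae_chartVolume_of_ae_target (g : SmoothMetric n M) (c : M) {P : M → Prop}
    (h : ∀ᵐ z ∂(volume.restrict (extChartAt (𝓡∂ n) c).target), P ((extChartAt (𝓡∂ n) c).symm z)) :
    ∀ᵐ x ∂(chartVolume g c), P x := by
  have h1 := ae_of_ae_map (aemeasurable_extChartAt g c) ((map_extChartAt_chartVolume_ac g c).ae_le h)
  filter_upwards [h1, chartVolume_ae_mem_source g c] with x hx hxs
  rwa [(extChartAt (𝓡∂ n) c).left_inv hxs] at hx

theorem aemeasurable_chartVolume (g : SmoothMetric n M) (c : M) {F : M → ℝ}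
    (h : AEMeasurable (fun z => F ((extChartAt (𝓡∂ n) c).symm z))
      (volume.restrict (extChartAt (𝓡∂ n) c).target)) :
    AEMeasurable F (chartVolume g c) := by
  have h1 := (h.mono_ac (map_extChartAt_chartVolume_ac g c)).comp_aemeasurable
    (aemeasurable_extChartAt g c)
  refine h1.congr ?_
  filter_upwards [chartVolume_ae_mem_source g c] with x hxs
  simp only [Function.comp_apply]
  rw [(extChartAt (𝓡∂ n) c).left_inv hxs]

theorem lintegral_chartVolume (g : SmoothMetric n M) (c : M) {F : M → ℝ≥0∞}
    (hF : AEMeasurable F (chartVolume g c)) :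
    ∫⁻ x, F x ∂(chartVolume g c) = ∫⁻ z in (extChartAt (𝓡∂ n) c).target,
      ENNReal.ofReal (Real.sqrt (gramMatrix g c z).det) * F ((extChartAt (𝓡∂ n) c).symm z) := by
  have h' := aemeasurable_extChartAt_symm g c
  rw [chartVolume] at hF ⊢
  rw [lintegral_map' hF h', lintegral_withDensity_eq_lintegral_mul_non_measurable₀ _
    (aemeasurable_chart_density g c) (ae_of_all _ fun _ => ENNReal.ofReal_lt_top)]
  rfl

theorem measurable_partition (c : M) :
    Measurable (fun x => ENNReal.ofReal (chartPartition n M c x)) :=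
  ((chartPartition n M c).contMDiff.continuous.measurable).ennreal_ofReal

/-- By compactness only finitely many charts contribute to the Riemannian measure. -/
theorem riemVolume_eq_finset_sum (g : SmoothMetric n M) :
    ∃ s : Finset M, riemVolume g = ∑ c ∈ s,
      (chartVolume g c).withDensity (fun x => ENNReal.ofReal (chartPartition n M c x)) := by
  have hfin : {c : M | (Function.support (chartPartition n M c)).Nonempty}.Finite :=
    (chartPartition n M).locallyFinite.finite_nonempty_of_compact
  refine ⟨hfin.toFinset, ?_⟩
  ext s hs
  rw [riemVolume, Measure.sum_apply _ hs, Measure.finsetSum_apply]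
  refine tsum_eq_sum fun c hc => ?_
  have h0 : ∀ x, chartPartition n M c x = 0 := by
    intro x
    by_contra hx
    exact hc (hfin.mem_toFinset.2 ⟨x, hx⟩)
  simp [h0]

theorem withDensity_chartVolume_le (g : SmoothMetric n M) (c : M) :
    (chartVolume g c).withDensity (fun x => ENNReal.ofReal (chartPartition n M c x)) ≤
      riemVolume g :=
  Measure.le_sum (fun c : M =>
    (chartVolume g c).withDensity (fun x => ENNReal.ofReal (chartPartition n M c x))) c

/-- A property that holds almost everywhere in the coordinates of every chart holds almost
everywhere for the Riemannian measure. -/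
theorem ae_riemVolume_of_charts (g : SmoothMetric n M) {P : M → Prop}
    (h : ∀ c : M, ∀ᵐ z ∂(volume.restrict (extChartAt (𝓡∂ n) c).target),
      P ((extChartAt (𝓡∂ n) c).symm z)) :
    ∀ᵐ x ∂(riemVolume g), P x := by
  obtain ⟨s, hs⟩ := riemVolume_eq_finset_sum g
  rw [hs, ae_iff, Measure.finsetSum_apply]
  refine Finset.sum_eq_zero fun c _ => ?_
  exact (withDensity_absolutelyContinuous _ _).ae_le (ae_chartVolume_of_ae_target g c (h c))

theorem aemeasurable_riemVolume (g : SmoothMetric n M) {F : M → ℝ}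
    (h : ∀ c : M, AEMeasurable (fun z => F ((extChartAt (𝓡∂ n) c).symm z))
      (volume.restrict (extChartAt (𝓡∂ n) c).target)) :
    AEMeasurable F (riemVolume g) := by
  obtain ⟨s, hs⟩ := riemVolume_eq_finset_sum g
  rw [hs, ← Measure.sum_coe_finset]
  refine (aemeasurable_sum_measure_iff).2 fun c => ?_
  exact (aemeasurable_chartVolume g c (h c)).mono_ac (withDensity_absolutelyContinuous _ _)

theorem ae_mem_interior (g : SmoothMetric n M) :
    ∀ᵐ x ∂(riemVolume g), x ∈ (𝓡∂ n).interior M := by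
  refine ae_riemVolume_of_charts g fun c => ?_
  filter_upwards [ae_mem_interior_target c,
    ae_restrict_mem (measurableSet_extChartAt_target c)] with z hz hzt
  exact (symm_mem_interior_iff c hzt).2 hz

theorem tsupport_partition_subset (c : M) :
    tsupport (chartPartition n M c) ⊆ (extChartAt (𝓡∂ n) c).source := by
  rw [extChartAt_source]
  exact (SmoothPartitionOfUnity.exists_isSubordinate_chartAt_source (𝓡∂ n) M).choose_spec c

instance isFiniteMeasure_riemVolume (g : SmoothMetric n M) : IsFiniteMeasure (riemVolume g) := by
  obtain ⟨s, hs⟩ := riemVolume_eq_finset_sum g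
  refine ⟨?_⟩
  rw [hs, Measure.finsetSum_apply]
  refine ENNReal.sum_lt_top.2 fun c _ => ?_
  let K : Set (RSpace n) := extChartAt (𝓡∂ n) c '' tsupport (chartPartition n M c)
  have hK : IsCompact K := (isClosed_tsupport _).isCompact.image_of_continuousOn
    ((continuousOn_extChartAt c).mono (tsupport_partition_subset c))
  have hKt : K ⊆ (extChartAt (𝓡∂ n) c).target := by
    rintro _ ⟨x, hx, rfl⟩
    exact (extChartAt (𝓡∂ n) c).map_source (tsupport_partition_subset c hx)
  obtain ⟨C, hC⟩ := hK.exists_bound_of_continuousOn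
    ((continuousOn_sqrt_det_gramMatrix g c).mono hKt)
  rw [withDensity_apply _ MeasurableSet.univ, Measure.restrict_univ,
    lintegral_chartVolume g c (measurable_partition c).aemeasurable]
  calc ∫⁻ z in (extChartAt (𝓡∂ n) c).target,
      ENNReal.ofReal (Real.sqrt (gramMatrix g c z).det) *
        ENNReal.ofReal (chartPartition n M c ((extChartAt (𝓡∂ n) c).symm z))
      ≤ ∫⁻ z in (extChartAt (𝓡∂ n) c).target, K.indicator (fun _ => ENNReal.ofReal C) z := by
        refine setLIntegral_mono' (measurableSet_extChartAt_target c) fun z hz => ?_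
        by_cases h : chartPartition n M c ((extChartAt (𝓡∂ n) c).symm z) = 0
        · rw [h, ENNReal.ofReal_zero, mul_zero]
          exact zero_le
        · have hzK : z ∈ K := ⟨_, subset_tsupport _ h, (extChartAt (𝓡∂ n) c).right_inv hz⟩
          rw [indicator_of_mem hzK, ← mul_one (ENNReal.ofReal C)]
          refine mul_le_mul' (ENNReal.ofReal_le_ofReal ?_) ?_
          · exact (le_abs_self _).trans (hC z hzK)
          · exact ENNReal.ofReal_le_one.2 ((chartPartition n M).le_one _ _)
    _ ≤ ∫⁻ z, K.indicator (fun _ => ENNReal.ofReal C) z := setLIntegral_le_lintegral _ _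
    _ = ENNReal.ofReal C * volume K := by
        rw [lintegral_indicator hK.measurableSet, setLIntegral_const]
    _ < ⊤ := ENNReal.mul_lt_top ENNReal.ofReal_lt_top hK.measure_lt_top

end ChartMeasure

/-! ### Vector fields, their norms and measurability; uniqueness of weak gradients -/

section Fields

variable {n : ℕ} [NeZero n] {M : Type*} [TopologicalSpace M]
  [ChartedSpace (EuclideanHalfSpace n) M] [IsManifold (𝓡∂ n) ∞ M]

theorem metric_inner_self_nonneg (g : SmoothMetric n M) (x : M) (v : TangentSpace (𝓡∂ n) x) :
    0 ≤ g.inner x v v := by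
  rcases eq_or_ne v 0 with rfl | hv
  · simp
  · exact (g.pos x v hv).le

theorem fieldNorm_nonneg (g : SmoothMetric n M) (V : VField n M) (x : M) : 0 ≤ fieldNorm g V x :=
  Real.sqrt_nonneg _

theorem fieldNorm_sq (g : SmoothMetric n M) (V : VField n M) (x : M) :
    fieldNorm g V x ^ 2 = g.inner x (V x) (V x) :=
  Real.sq_sqrt (metric_inner_self_nonneg g x _)

theorem fieldNorm_eq_zero (g : SmoothMetric n M) {V : VField n M} {x : M} :
    fieldNorm g V x = 0 ↔ V x = 0 := by
  constructor
  · intro h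
    by_contra hv
    have h1 := fieldNorm_sq g V x
    rw [h] at h1
    have := g.pos x (V x) hv
    norm_num at h1
    linarith
  · intro h
    simp [fieldNorm, h]

theorem fieldNorm_congr (g : SmoothMetric n M) {V W : VField n M} {x : M} (h : V x = W x) :
    fieldNorm g V x = fieldNorm g W x := by
  simp [fieldNorm, h]

theorem sq_inner_le (g : SmoothMetric n M) (x : M) (v w : TangentSpace (𝓡∂ n) x) :
    g.inner x v w ^ 2 ≤ g.inner x v v * g.inner x w w := by
  rcases eq_or_ne w 0 with rfl | hw
  · simp
  · have hpos := g.pos x w hw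
    have h := metric_inner_self_nonneg g x ((g.inner x w w) • v - (g.inner x v w) • w)
    simp only [map_sub, map_smul, sub_apply, smul_apply, smul_eq_mul] at h
    rw [g.symm x w v] at h
    have h2 : 0 ≤ g.inner x w w * (g.inner x v v * g.inner x w w - g.inner x v w ^ 2) := by
      nlinarith [h]
    nlinarith [nonneg_of_mul_nonneg_right h2 hpos]

theorem abs_inner_le (g : SmoothMetric n M) (V W : VField n M) (x : M) :
    |g.inner x (V x) (W x)| ≤ fieldNorm g V x * fieldNorm g W x := by
  refine abs_le_of_sq_le_sq ?_ (mul_nonneg (fieldNorm_nonneg g V x) (fieldNorm_nonneg g W x))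
  rw [mul_pow, fieldNorm_sq, fieldNorm_sq]
  exact sq_inner_le g x _ _

theorem fieldNorm_sub_sq (g : SmoothMetric n M) (V W : VField n M) (x : M) :
    fieldNorm g (V - W) x ^ 2 =
      fieldNorm g V x ^ 2 - 2 * g.inner x (V x) (W x) + fieldNorm g W x ^ 2 := by
  rw [fieldNorm_sq, fieldNorm_sq, fieldNorm_sq]
  simp only [Pi.sub_apply, map_sub, sub_apply]
  rw [g.symm x (W x) (V x)]
  ring

theorem fieldNorm_sub_le (g : SmoothMetric n M) (V W : VField n M) (x : M) :
    fieldNorm g (V - W) x ≤ fieldNorm g V x + fieldNorm g W x := by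
  refine abs_le_of_sq_le_sq' ?_ (add_nonneg (fieldNorm_nonneg g V x) (fieldNorm_nonneg g W x)) |>.2
  rw [fieldNorm_sub_sq]
  have := (abs_le.1 (abs_inner_le g V W x)).1
  nlinarith

theorem fieldNorm_smul (g : SmoothMetric n M) (s : M → ℝ) (V : VField n M) (x : M) :
    fieldNorm g (fun y => s y • V y) x = |s x| * fieldNorm g V x := by
  simp only [fieldNorm, map_smul, smul_apply, smul_eq_mul]
  rw [← mul_assoc, Real.sqrt_mul (mul_self_nonneg _), Real.sqrt_mul_self_eq_abs]

theorem fieldNorm_neg (g : SmoothMetric n M) (V : VField n M) (x : M) :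
    fieldNorm g (-V) x = fieldNorm g V x := by
  simp [fieldNorm]

theorem fieldNorm_add_le (g : SmoothMetric n M) (V W : VField n M) (x : M) :
    fieldNorm g (V + W) x ≤ fieldNorm g V x + fieldNorm g W x := by
  have := fieldNorm_sub_le g V (-W) x
  rwa [sub_neg_eq_add, fieldNorm_neg] at this

/-- A vector field whose components `g(V, ∂_e)` are measurable in every chart. -/
def ChartMeasurable (g : SmoothMetric n M) (V : VField n M) : Prop :=
  ∀ (c : M) (e : RSpace n), AEMeasurable (fun z => g.inner ((extChartAt (𝓡∂ n) c).symm z)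
    (V ((extChartAt (𝓡∂ n) c).symm z)) (coordVector c z e))
    (volume.restrict (extChartAt (𝓡∂ n) c).target)

theorem ChartMeasurable.sub {g : SmoothMetric n M} {V W : VField n M} (hV : ChartMeasurable g V)
    (hW : ChartMeasurable g W) : ChartMeasurable g (V - W) := by
  intro c e
  refine ((hV c e).sub (hW c e)).congr (ae_of_all _ fun z => ?_)
  simp only [Pi.sub_apply, map_sub, sub_apply]

/-- The inner product of two vectors in terms of their components `g(V, ∂_i)`, through the inverse
of the Gram matrix. -/
theorem inner_eq_dotProduct_gramMatrix_inv (g : SmoothMetric n M) (c : M) {z : RSpace n}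
    (hz : z ∈ (extChartAt (𝓡∂ n) c).target)
    (v w : TangentSpace (𝓡∂ n) ((extChartAt (𝓡∂ n) c).symm z)) :
    g.inner ((extChartAt (𝓡∂ n) c).symm z) v w =
      (fun i => g.inner ((extChartAt (𝓡∂ n) c).symm z) v
        (coordVector c z (EuclideanSpace.basisFun (Fin n) ℝ i))) ⬝ᵥ
      ((gramMatrix g c z)⁻¹.mulVec (fun i => g.inner ((extChartAt (𝓡∂ n) c).symm z) w
        (coordVector c z (EuclideanSpace.basisFun (Fin n) ℝ i)))) := by
  obtain ⟨e, rfl⟩ := coordVector_surjective c hz w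
  have he : e = ∑ i, e i • EuclideanSpace.basisFun (Fin n) ℝ i := by
    have := (EuclideanSpace.basisFun (Fin n) ℝ).sum_repr e
    simpa using this.symm
  have hw : (fun j => g.inner ((extChartAt (𝓡∂ n) c).symm z) (coordVector c z e)
      (coordVector c z (EuclideanSpace.basisFun (Fin n) ℝ j))) =
      (gramMatrix g c z).mulVec (fun i => e i) := by
    ext j
    conv_lhs => rw [he, coordVector_sum]
    simp only [map_sum, map_smul, sum_apply, smul_apply, Matrix.mulVec, dotProduct, gramMatrix,
      smul_eq_mul]
    refine Finset.sum_congr rfl fun i _ => ?_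
    rw [g.symm, mul_comm]
  rw [hw, Matrix.mulVec_mulVec, Matrix.nonsing_inv_mul _
    (gramMatrix_det_pos g c hz).ne'.isUnit, Matrix.one_mulVec]
  conv_lhs => rw [he, coordVector_sum]
  simp only [map_sum, map_smul, dotProduct, smul_eq_mul]
  exact Finset.sum_congr rfl fun i _ => mul_comm _ _

theorem aemeasurable_gramMatrix_inv (g : SmoothMetric n M) (c : M) (i j : Fin n) :
    AEMeasurable (fun z => (gramMatrix g c z)⁻¹ i j)
      (volume.restrict (extChartAt (𝓡∂ n) c).target) := by
  refine ContinuousOn.aemeasurable ?_ (measurableSet_extChartAt_target c)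
  have h := continuousOn_gramMatrix g c
  have h1 : ContinuousOn (fun z => (gramMatrix g c z).det) (extChartAt (𝓡∂ n) c).target :=
    (Continuous.matrix_det continuous_id).comp_continuousOn h
  have h2 : ContinuousOn (fun z => (gramMatrix g c z).adjugate) (extChartAt (𝓡∂ n) c).target :=
    (Continuous.matrix_adjugate continuous_id).comp_continuousOn h
  have h3 : ContinuousOn (fun z => ((gramMatrix g c z).det)⁻¹ * (gramMatrix g c z).adjugate i j)
      (extChartAt (𝓡∂ n) c).target :=
    (h1.inv₀ fun z hz => (gramMatrix_det_pos g c hz).ne').mul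
      (continuousOn_pi.1 (continuousOn_pi.1 h2 i) j)
  refine h3.congr fun z hz => ?_
  rw [Matrix.inv_def, Ring.inverse_eq_inv]
  simp

theorem ChartMeasurable.of_hasWeakGradient {g : SmoothMetric n M} {u : M → ℝ} {V : VField n M}
    (h : HasWeakGradient g u V) : ChartMeasurable g V := by
  intro c e
  have h1 := (((h c).2 e).1).aestronglyMeasurable.aemeasurable
  rwa [restrict_interior_extChartAt_target] at h1

theorem IsTestFunction.contDiffOn {θ : M → ℝ} (hθ : IsTestFunction n θ) (c : M) :
    ContDiffOn ℝ ∞ (fun z => θ ((extChartAt (𝓡∂ n) c).symm z))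
      (extChartAt (𝓡∂ n) c).target := by
  rw [← contMDiffOn_iff_contDiffOn]
  exact hθ.1.comp_contMDiffOn (contMDiffOn_extChartAt_symm c)

/-- In coordinates, the components of the gradient of a test function are its partial derivatives. -/
theorem inner_grad_coordVector (g : SmoothMetric n M) {θ : M → ℝ} (hθ : IsTestFunction n θ)
    (c : M) {z : RSpace n} (hz : z ∈ interior (extChartAt (𝓡∂ n) c).target) (e : RSpace n) :
    g.inner ((extChartAt (𝓡∂ n) c).symm z) (grad g θ ((extChartAt (𝓡∂ n) c).symm z))
      (coordVector c z e) = fderiv ℝ (fun z => θ ((extChartAt (𝓡∂ n) c).symm z)) z e := by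
  rw [inner_grad]
  have hzt := interior_subset hz
  have hr : range (𝓡∂ n) ∈ 𝓝 z :=
    mem_of_superset (mem_interior_iff_mem_nhds.1 hz) (extChartAt_target_subset_range c)
  have h1 : MDifferentiableAt (𝓡∂ n) 𝓘(ℝ, ℝ) θ ((extChartAt (𝓡∂ n) c).symm z) :=
    hθ.1.mdifferentiableAt (by simp)
  have h2 : MDifferentiableWithinAt 𝓘(ℝ, RSpace n) (𝓡∂ n) (extChartAt (𝓡∂ n) c).symm
      (range (𝓡∂ n)) z := mdifferentiableWithinAt_extChartAt_symm hzt
  have h3 := mfderiv_comp_mfderivWithin z h1 h2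
    ((uniqueMDiffWithinAt_iff_uniqueDiffWithinAt).2 (uniqueDiffWithinAt_of_mem_nhds hr))
  have h4 : mfderivWithin 𝓘(ℝ, RSpace n) 𝓘(ℝ, ℝ) (θ ∘ (extChartAt (𝓡∂ n) c).symm)
      (range (𝓡∂ n)) z = fderiv ℝ (fun z => θ ((extChartAt (𝓡∂ n) c).symm z)) z := by
    rw [mfderivWithin_eq_fderivWithin, fderivWithin_of_mem_nhds hr]; rfl
  rw [← h4, h3]
  rfl

theorem IsTestFunction.chartMeasurable_grad (g : SmoothMetric n M) {θ : M → ℝ}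
    (hθ : IsTestFunction n θ) : ChartMeasurable g (grad g θ) := by
  intro c e
  rw [← restrict_interior_extChartAt_target]
  refine ContinuousOn.aemeasurable ?_ isOpen_interior.measurableSet
  have h3 := ((hθ.contDiffOn c).mono interior_subset).continuousOn_fderiv_of_isOpen
    isOpen_interior (by simp)
  exact (h3.clm_apply continuousOn_const).congr fun z hz => inner_grad_coordVector g hθ c hz e

theorem ChartMeasurable.aemeasurable_inner_chart {g : SmoothMetric n M} {V W : VField n M}
    (hV : ChartMeasurable g V) (hW : ChartMeasurable g W) (c : M) :
    AEMeasurable (fun z => g.inner ((extChartAt (𝓡∂ n) c).symm z)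
      (V ((extChartAt (𝓡∂ n) c).symm z)) (W ((extChartAt (𝓡∂ n) c).symm z)))
      (volume.restrict (extChartAt (𝓡∂ n) c).target) := by
  have h : AEMeasurable (fun z => ∑ i, (g.inner ((extChartAt (𝓡∂ n) c).symm z)
      (V ((extChartAt (𝓡∂ n) c).symm z))
        (coordVector c z (EuclideanSpace.basisFun (Fin n) ℝ i))) *
      ∑ j, (gramMatrix g c z)⁻¹ i j * (g.inner ((extChartAt (𝓡∂ n) c).symm z)
      (W ((extChartAt (𝓡∂ n) c).symm z))
        (coordVector c z (EuclideanSpace.basisFun (Fin n) ℝ j))))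
      (volume.restrict (extChartAt (𝓡∂ n) c).target) := by
    refine Finset.aemeasurable_fun_sum _ fun i _ => (hV c _).mul ?_
    exact Finset.aemeasurable_fun_sum _ fun j _ => (aemeasurable_gramMatrix_inv g c i j).mul (hW c _)
  refine h.congr ?_
  filter_upwards [ae_restrict_mem (measurableSet_extChartAt_target c)] with z hz
  exact (inner_eq_dotProduct_gramMatrix_inv g c hz _ _).symm

variable [T2Space M] [CompactSpace M] [MeasurableSpace M] [BorelSpace M]

theorem ChartMeasurable.aemeasurable_inner {g : SmoothMetric n M} {V W : VField n M}
    (hV : ChartMeasurable g V) (hW : ChartMeasurable g W) :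
    AEMeasurable (fun x => g.inner x (V x) (W x)) (riemVolume g) :=
  aemeasurable_riemVolume g fun c => hV.aemeasurable_inner_chart hW c

theorem ChartMeasurable.aemeasurable_fieldNorm {g : SmoothMetric n M} {V : VField n M}
    (hV : ChartMeasurable g V) : AEMeasurable (fieldNorm g V) (riemVolume g) :=
  (hV.aemeasurable_inner hV).sqrt

/-- Weak gradients are unique up to a null set. -/
theorem HasWeakGradient.ae_eq {g : SmoothMetric n M} {u : M → ℝ} {V W : VField n M}
    (hV : HasWeakGradient g u V) (hW : HasWeakGradient g u W) :
    ∀ᵐ x ∂(riemVolume g), V x = W x := by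
  refine ae_riemVolume_of_charts g fun c => ?_
  have key : ∀ e : RSpace n, ∀ᵐ z : RSpace n, z ∈ interior (extChartAt (𝓡∂ n) c).target →
      g.inner ((extChartAt (𝓡∂ n) c).symm z) (V ((extChartAt (𝓡∂ n) c).symm z))
          (coordVector c z e) -
        g.inner ((extChartAt (𝓡∂ n) c).symm z) (W ((extChartAt (𝓡∂ n) c).symm z))
          (coordVector c z e) = 0 := by
    intro e
    have hVe := ((hV c).2 e).1
    have hWe := ((hW c).2 e).1
    refine isOpen_interior.ae_eq_zero_of_integral_contDiff_smul_eq_zero (hVe.sub hWe) ?_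
    intro ψ hψ hc hs
    have hint : ∀ F : RSpace n → ℝ,
        LocallyIntegrableOn F (interior (extChartAt (𝓡∂ n) c).target) volume →
        Integrable (fun z => F z * ψ z) := by
      intro F hF
      have h1 := (hF.integrableOn_compact_subset hs hc).mul_continuousOn
        hψ.continuous.continuousOn hc
      rwa [integrableOn_iff_integrable_of_support_subset] at h1
      intro z hz
      exact subset_tsupport _ (right_ne_zero_of_mul hz)
    have h1 := ((hV c).2 e).2 ψ hψ hc hs
    have h2 := ((hW c).2 e).2 ψ hψ hc hs
    simp only [smul_eq_mul]
    calc _ = ∫ z, (g.inner ((extChartAt (𝓡∂ n) c).symm z) (V ((extChartAt (𝓡∂ n) c).symm z))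
            (coordVector c z e) * ψ z -
          g.inner ((extChartAt (𝓡∂ n) c).symm z) (W ((extChartAt (𝓡∂ n) c).symm z))
            (coordVector c z e) * ψ z) := by
          congr 1; ext z; ring
      _ = _ := integral_sub (hint _ hVe) (hint _ hWe)
      _ = 0 := by linarith
  rw [ae_restrict_iff' (measurableSet_extChartAt_target c)]
  have hint := (ae_restrict_iff' (measurableSet_extChartAt_target c)).1 (ae_mem_interior_target (n := n) c)
  have hall : ∀ᵐ z : RSpace n, ∀ i : Fin n, z ∈ interior (extChartAt (𝓡∂ n) c).target →
      g.inner ((extChartAt (𝓡∂ n) c).symm z) (V ((extChartAt (𝓡∂ n) c).symm z))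
          (coordVector c z (EuclideanSpace.basisFun (Fin n) ℝ i)) -
        g.inner ((extChartAt (𝓡∂ n) c).symm z) (W ((extChartAt (𝓡∂ n) c).symm z))
          (coordVector c z (EuclideanSpace.basisFun (Fin n) ℝ i)) = 0 :=
    ae_all_iff.2 fun i => key _
  filter_upwards [hint, hall] with z h1 h2 hz
  have h3 := inner_eq_dotProduct_gramMatrix_inv g c hz
    (V ((extChartAt (𝓡∂ n) c).symm z) - W ((extChartAt (𝓡∂ n) c).symm z))
    (V ((extChartAt (𝓡∂ n) c).symm z) - W ((extChartAt (𝓡∂ n) c).symm z))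
  have h4 : (fun i => g.inner ((extChartAt (𝓡∂ n) c).symm z)
      (V ((extChartAt (𝓡∂ n) c).symm z) - W ((extChartAt (𝓡∂ n) c).symm z))
        (coordVector c z (EuclideanSpace.basisFun (Fin n) ℝ i))) = 0 := by
    ext i
    rw [Pi.zero_apply, map_sub, sub_apply]
    exact h2 i (h1 hz)
  rw [h4, zero_dotProduct] at h3
  by_contra hne
  exact (g.pos _ _ (sub_ne_zero.2 hne)).ne' h3

end Fields

/-! ### Sequences with summable derivatives in a convex set -/

section Dichotomy

variable {E : Type*} [NormedAddCommGroup E] [NormedSpace ℝ E] [FiniteDimensional ℝ E]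
  [MeasurableSpace E] [BorelSpace E] (μ : Measure E) [μ.IsAddHaarMeasure]

/-- The increment of `ψ` is bounded by the integral of its derivative along the segment. The indicator
function allows integration over all starting points. -/
theorem enorm_sub_le_lintegral_fderiv {B : Set E} (hB : IsOpen B) (hc : Convex ℝ B) {ψ : E → ℝ}
    (hψ : ContDiffOn ℝ 1 ψ B) {x h : E} (hx : x ∈ B) (hxh : x + h ∈ B) :
    ‖ψ (x + h) - ψ x‖ₑ ≤
      ∫⁻ t in Ioc (0 : ℝ) 1, B.indicator (fun z => ‖fderiv ℝ ψ z h‖ₑ) (x + t • h) := by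
  have hseg : ∀ t ∈ Icc (0 : ℝ) 1, x + t • h ∈ B := fun t ht => by
    have := hc.add_smul_mem hx hxh ht
    exact this
  have hd : ∀ t ∈ uIcc (0 : ℝ) 1, HasDerivAt (fun t : ℝ => ψ (x + t • h))
      (fderiv ℝ ψ (x + t • h) h) t := by
    intro t ht
    rw [uIcc_of_le zero_le_one] at ht
    have h1 : HasFDerivAt ψ (fderiv ℝ ψ (x + t • h)) (x + t • h) :=
      ((hψ.differentiableOn one_ne_zero).differentiableAt
        (hB.mem_nhds (hseg t ht))).hasFDerivAt
    have h2 : HasDerivAt (fun t : ℝ => x + t • h) h t := by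
      simpa using ((hasDerivAt_id t).smul_const h).const_add x
    exact h1.comp_hasDerivAt t h2
  have hcont : ContinuousOn (fun t : ℝ => fderiv ℝ ψ (x + t • h) h) (uIcc (0 : ℝ) 1) := by
    rw [uIcc_of_le zero_le_one]
    refine ((hψ.continuousOn_fderiv_of_isOpen hB le_rfl).comp ?_ hseg).clm_apply continuousOn_const
    fun_prop
  have hint := intervalIntegral.integral_eq_sub_of_hasDerivAt hd hcont.intervalIntegrable
  simp only [one_smul, zero_smul, add_zero] at hint
  rw [← hint, intervalIntegral.integral_of_le zero_le_one]
  refine (enorm_integral_le_lintegral_enorm _).trans ?_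
  refine setLIntegral_mono' measurableSet_Ioc fun t ht => ?_
  rw [indicator_of_mem (hseg t (Ioc_subset_Icc_self ht))]

/-- If the directional derivatives in direction `h` are summable in `L¹` of a convex open set, then
the increments in direction `h` tend to zero almost everywhere. -/
theorem ae_tendsto_increment {B : Set E} (hB : IsOpen B) (hc : Convex ℝ B) {ψ : ℕ → E → ℝ}
    (hψ : ∀ m, ContDiffOn ℝ 1 (ψ m) B) (h : E)
    (hsum : ∑' m, ∫⁻ z in B, ‖fderiv ℝ (ψ m) z h‖ₑ ∂μ ≠ ⊤) :
    ∀ᵐ x ∂μ, x ∈ B → x + h ∈ B →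
      Tendsto (fun m => ψ m (x + h) - ψ m x) atTop (𝓝 0) := by
  let D : ℕ → E → ℝ≥0∞ := fun m => B.indicator (fun z => ‖fderiv ℝ (ψ m) z h‖ₑ)
  have hD : ∀ m, Measurable (D m) := fun m =>
    ((measurable_fderiv_apply_const ℝ (ψ m) h).enorm).indicator hB.measurableSet
  have hD2 : ∀ m, Measurable (fun q : E × ℝ => D m (q.1 + q.2 • h)) := fun m =>
    (hD m).comp (by fun_prop)
  have hmeas : ∀ m, Measurable (fun x => ∫⁻ t in Ioc (0 : ℝ) 1, D m (x + t • h)) := fun m =>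
    (hD2 m).lintegral_prod_right'
  have hI : ∀ m, ∫⁻ x, (∫⁻ t in Ioc (0 : ℝ) 1, D m (x + t • h)) ∂μ =
      ∫⁻ z in B, ‖fderiv ℝ (ψ m) z h‖ₑ ∂μ := by
    intro m
    rw [lintegral_lintegral_swap (f := fun x t => D m (x + t • h)) (hD2 m).aemeasurable]
    have : ∀ t : ℝ, ∫⁻ x, D m (x + t • h) ∂μ = ∫⁻ z in B, ‖fderiv ℝ (ψ m) z h‖ₑ ∂μ := by
      intro t
      rw [lintegral_add_right_eq_self (D m) (t • h), lintegral_indicator hB.measurableSet]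
    simp [this]
  have hfin : ∫⁻ x, (∑' m, ∫⁻ t in Ioc (0 : ℝ) 1, D m (x + t • h)) ∂μ ≠ ⊤ := by
    rw [lintegral_tsum fun m => (hmeas m).aemeasurable]
    simpa only [hI] using hsum
  have hae := ae_lt_top (Measurable.tsum hmeas) hfin
  filter_upwards [hae] with x hx hxB hxh
  have h0 := ENNReal.tendsto_atTop_zero_of_tsum_ne_top hx.ne
  rw [tendsto_zero_iff_enorm_tendsto_zero]
  exact tendsto_of_tendsto_of_tendsto_of_le_of_le tendsto_const_nhds h0 (fun _ => zero_le)
    fun m => enorm_sub_le_lintegral_fderiv hB hc (hψ m) hxB hxh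

/-- If all directional derivatives of a sequence are summable in `L¹` of a convex open set `B`, then
the sequence tends to zero almost everywhere in `B` or almost nowhere in `B`: convergence to zero
propagates by every translation. -/
theorem measure_tendsto_zero_dichotomy {B : Set E} (hB : IsOpen B) (hc : Convex ℝ B)
    {ψ : ℕ → E → ℝ} (hm : ∀ m, Measurable (ψ m)) (hψ : ∀ m, ContDiffOn ℝ 1 (ψ m) B)
    (hsum : ∀ h : E, ∑' m, ∫⁻ z in B, ‖fderiv ℝ (ψ m) z h‖ₑ ∂μ ≠ ⊤) :
    μ {x ∈ B | Tendsto (fun m => ψ m x) atTop (𝓝 0)} = 0 ∨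
      μ {x ∈ B | ¬ Tendsto (fun m => ψ m x) atTop (𝓝 0)} = 0 := by
  have hT : MeasurableSet {x | Tendsto (fun m => ψ m x) atTop (𝓝 0)} :=
    measurableSet_tendsto _ hm
  set A := {x ∈ B | Tendsto (fun m => ψ m x) atTop (𝓝 0)} with hA
  set N := {x ∈ B | ¬ Tendsto (fun m => ψ m x) atTop (𝓝 0)} with hN
  have hAm : MeasurableSet A := hB.measurableSet.inter hT
  have hNm : MeasurableSet N := hB.measurableSet.inter hT.compl
  -- no translation sends a non-null part of `A` into `N`
  have hz : ∀ h : E, ∫⁻ x, A.indicator 1 x * N.indicator 1 (x + h) ∂μ = 0 := by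
    intro h
    refine (lintegral_congr_ae (g := fun _ => 0) ?_).trans (by simp)
    filter_upwards [ae_tendsto_increment μ hB hc hψ h (hsum h)] with x hx
    by_cases hxA : x ∈ A
    · by_cases hxN : x + h ∈ N
      · exfalso
        have h1 := (hx hxA.1 hxN.1).add hxA.2
        simp only [sub_add_cancel, add_zero] at h1
        exact hxN.2 h1
      · simp [hxN]
    · simp [hxA]
  have hmeas : Measurable (fun q : E × E => A.indicator (1 : E → ℝ≥0∞) q.1 *
      N.indicator (1 : E → ℝ≥0∞) (q.1 + q.2)) :=
    ((measurable_one.indicator hAm).comp measurable_fst).mul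
      ((measurable_one.indicator hNm).comp (by fun_prop))
  -- integrating over all translations `h` gives `μ A * μ N`
  have hswap := lintegral_lintegral_swap (μ := μ) (ν := μ) (f := fun x h : E =>
    A.indicator (1 : E → ℝ≥0∞) x * N.indicator (1 : E → ℝ≥0∞) (x + h)) hmeas.aemeasurable
  simp only [hz, lintegral_zero] at hswap
  have h2 : ∀ x : E, ∫⁻ h, A.indicator (1 : E → ℝ≥0∞) x * N.indicator 1 (x + h) ∂μ =
      A.indicator 1 x * μ N := by
    intro x
    have hNx : Measurable (fun h => N.indicator (1 : E → ℝ≥0∞) (x + h)) :=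
      (measurable_one.indicator hNm).comp (measurable_const_add x)
    rw [lintegral_const_mul _ hNx,
      lintegral_add_left_eq_self (N.indicator (1 : E → ℝ≥0∞)) x, lintegral_indicator_one hNm]
  simp only [h2] at hswap
  rw [lintegral_mul_const _ (measurable_one.indicator hAm), lintegral_indicator_one hAm] at hswap
  exact mul_eq_zero.1 hswap

end Dichotomy

/-! ### Null sets and test functions in charts -/

section Propagation

variable {n : ℕ} [NeZero n] {M : Type*} [TopologicalSpace M]
  [ChartedSpace (EuclideanHalfSpace n) M] [IsManifold (𝓡∂ n) ∞ M]

/-- `P` holds almost everywhere on `U`, for Lebesgue measure in the coordinates of every chart. Unlike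
a statement on the Riemannian measure, it can be checked in a single chart (`AEOn.of_chart`). -/
def AEOn (n : ℕ) [NeZero n] {M : Type*} [TopologicalSpace M]
    [ChartedSpace (EuclideanHalfSpace n) M] (U : Set M) (P : M → Prop) : Prop :=
  ∀ c : M, ∀ᵐ z ∂(volume.restrict (extChartAt (𝓡∂ n) c).target),
    (extChartAt (𝓡∂ n) c).symm z ∈ U → P ((extChartAt (𝓡∂ n) c).symm z)

/-- Changes of charts are differentiable, hence preserve null sets: on a subset of one chart domain,
it is enough to check an almost everywhere property in that chart. -/
theorem AEOn.of_chart {U : Set M} {P : M → Prop} {c : M} (hU : U ⊆ (extChartAt (𝓡∂ n) c).source)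
    (h : ∀ᵐ z ∂(volume.restrict (extChartAt (𝓡∂ n) c).target),
      (extChartAt (𝓡∂ n) c).symm z ∈ U → P ((extChartAt (𝓡∂ n) c).symm z)) :
    AEOn n U P := by
  intro c'
  rw [ae_restrict_iff' (measurableSet_extChartAt_target c), ae_iff] at h
  rw [ae_restrict_iff' (measurableSet_extChartAt_target c'), ae_iff]
  set S : Set (RSpace n) := {w | ¬ (w ∈ (extChartAt (𝓡∂ n) c).target →
    (extChartAt (𝓡∂ n) c).symm w ∈ U → P ((extChartAt (𝓡∂ n) c).symm w))} ∩
      {w | (extChartAt (𝓡∂ n) c).symm w ∈ (extChartAt (𝓡∂ n) c').source} with hS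
  have hdiff : DifferentiableOn ℝ
      (fun w => extChartAt (𝓡∂ n) c' ((extChartAt (𝓡∂ n) c).symm w)) S := by
    have h1 : ContMDiffOn 𝓘(ℝ, RSpace n) 𝓘(ℝ, RSpace n) 1
        (extChartAt (𝓡∂ n) c' ∘ (extChartAt (𝓡∂ n) c).symm) S := by
      refine (contMDiffOn_extChartAt (I := 𝓡∂ n) (n := 1) (x := c')).comp
        ((contMDiffOn_extChartAt_symm (I := 𝓡∂ n) (n := 1) c).mono ?_) ?_
      · intro w hw
        have := hw.1
        simp only [mem_ofPred_eq, Classical.not_imp] at this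
        exact this.1
      · intro w hw
        have := hw.2
        rwa [mem_ofPred_eq, extChartAt_source] at this
    exact (contMDiffOn_iff_contDiffOn.1 h1).differentiableOn one_ne_zero
  have h0 := addHaar_image_eq_zero_of_differentiableOn_of_addHaar_eq_zero volume hdiff
    (measure_mono_null inter_subset_left h)
  refine measure_mono_null ?_ h0
  intro z hz
  simp only [mem_ofPred_eq, Classical.not_imp] at hz
  obtain ⟨hzt, hzU, hzP⟩ := hz
  have hzs := (extChartAt (𝓡∂ n) c').map_target hzt
  refine ⟨extChartAt (𝓡∂ n) c ((extChartAt (𝓡∂ n) c').symm z), ⟨?_, ?_⟩, ?_⟩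
  · simp only [mem_ofPred_eq, Classical.not_imp]
    rw [(extChartAt (𝓡∂ n) c).left_inv (hU hzU)]
    exact ⟨(extChartAt (𝓡∂ n) c).map_source (hU hzU), hzU, hzP⟩
  · rw [mem_ofPred_eq, (extChartAt (𝓡∂ n) c).left_inv (hU hzU)]
    exact hzs
  · dsimp only
    rw [(extChartAt (𝓡∂ n) c).left_inv (hU hzU), (extChartAt (𝓡∂ n) c').right_inv hzt]

theorem AEOn.mono {U V : Set M} {P : M → Prop} (h : AEOn n U P) (hV : V ⊆ U) : AEOn n V P :=
  fun c => (h c).mono fun _ hz hzV => hz (hV hzV)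

/-- A nonempty open set of `M` has positive measure in each chart that it meets. -/
theorem volume_preimage_pos_of_isOpen {c : M} {V : Set M} (hV : IsOpen V) {y : M} (hy : y ∈ V)
    (hyc : y ∈ (extChartAt (𝓡∂ n) c).source) :
    0 < volume (interior (extChartAt (𝓡∂ n) c).target ∩ (extChartAt (𝓡∂ n) c).symm ⁻¹' V) := by
  have hO : IsOpen (interior (extChartAt (𝓡∂ n) c).target ∩ (extChartAt (𝓡∂ n) c).symm ⁻¹' V) :=
    ((continuousOn_extChartAt_symm c).mono interior_subset).isOpen_inter_preimage isOpen_interior hV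
  refine hO.measure_pos volume ?_
  have hyt := (extChartAt (𝓡∂ n) c).map_source hyc
  have h1 : (extChartAt (𝓡∂ n) c).target ∩ (extChartAt (𝓡∂ n) c).symm ⁻¹' V ∈
      𝓝[range (𝓡∂ n)] (extChartAt (𝓡∂ n) c y) := by
    refine inter_mem (extChartAt_target_mem_nhdsWithin_of_mem hyt) ?_
    have h2 := (continuousOn_extChartAt_symm (I := 𝓡∂ n) c _ hyt).mono_of_mem_nhdsWithin
      (extChartAt_target_mem_nhdsWithin_of_mem hyt)
    refine h2.preimage_mem_nhdsWithin (hV.mem_nhds ?_)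
    rwa [(extChartAt (𝓡∂ n) c).left_inv hyc]
  obtain ⟨W, hWo, hyW, hW⟩ := mem_nhdsWithin.1 h1
  have hcl := (𝓡∂ n).range_subset_closure_interior (extChartAt_target_subset_range c hyt)
  obtain ⟨q, hqW, hqi⟩ := mem_closure_iff.1 hcl W hWo hyW
  have hq := hW ⟨hqW, interior_subset hqi⟩
  exact ⟨q, mem_interior_target_of_mem_interior_range c hq.1 hqi, hq.2⟩

/-- A function on `M` read in the chart around `c`, and extended by zero. -/
noncomputable def chartExtend (n : ℕ) [NeZero n] {M : Type*} [TopologicalSpace M]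
    [ChartedSpace (EuclideanHalfSpace n) M] (c : M) (θ : M → ℝ) : RSpace n → ℝ :=
  (extChartAt (𝓡∂ n) c).target.indicator fun z => θ ((extChartAt (𝓡∂ n) c).symm z)

theorem chartExtend_eventuallyEq (c : M) (θ : M → ℝ) {z : RSpace n}
    (hz : z ∈ interior (extChartAt (𝓡∂ n) c).target) :
    chartExtend n c θ =ᶠ[𝓝 z] fun z => θ ((extChartAt (𝓡∂ n) c).symm z) := by
  filter_upwards [mem_interior_iff_mem_nhds.1 hz] with w hw
  exact indicator_of_mem hw _

/-- Invariance of the interior under changes of charts ensures that the points of the domain that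
are not interior to it in coordinates are boundary points, away from the support of a test function. -/
theorem chartExtend_eventuallyEq_zero (c : M) {θ : M → ℝ} (hθ : IsTestFunction n θ) {r : ℝ}
    {z₀ : RSpace n} (hr : Metric.ball z₀ r ∩ range (𝓡∂ n) ⊆ (extChartAt (𝓡∂ n) c).target)
    {z : RSpace n} (hzB : z ∈ Metric.ball z₀ r)
    (hz : z ∉ interior (extChartAt (𝓡∂ n) c).target) :
    chartExtend n c θ =ᶠ[𝓝 z] fun _ => 0 := by
  by_cases hzr : z ∈ range (𝓡∂ n)
  · have hzt := hr ⟨hzB, hzr⟩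
    have hs : (extChartAt (𝓡∂ n) c).symm z ∉ tsupport θ := fun h =>
      hz ((symm_mem_interior_iff c hzt).1 (hθ.2.2 h))
    have h1 : ∀ᶠ w in 𝓝[(extChartAt (𝓡∂ n) c).target] z,
        (extChartAt (𝓡∂ n) c).symm w ∈ (tsupport θ)ᶜ :=
      (continuousOn_extChartAt_symm (I := 𝓡∂ n) c z hzt).preimage_mem_nhdsWithin
        ((isClosed_tsupport θ).isOpen_compl.mem_nhds hs)
    filter_upwards [eventually_nhdsWithin_iff.1 h1] with w hw
    by_cases hwt : w ∈ (extChartAt (𝓡∂ n) c).target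
    · rw [chartExtend, indicator_of_mem hwt]
      exact image_eq_zero_of_notMem_tsupport (hw hwt)
    · exact indicator_of_notMem hwt _
  · filter_upwards [(𝓡∂ n).isClosed_range.isOpen_compl.mem_nhds hzr] with w hw
    exact indicator_of_notMem (fun h => hw (extChartAt_target_subset_range c h)) _

/-- A test function vanishes near the boundary, so that its extension by zero is smooth across
the boundary of the half-space. -/
theorem contDiffOn_chartExtend (c : M) {θ : M → ℝ} (hθ : IsTestFunction n θ) {r : ℝ}
    {z₀ : RSpace n} (hr : Metric.ball z₀ r ∩ range (𝓡∂ n) ⊆ (extChartAt (𝓡∂ n) c).target) :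
    ContDiffOn ℝ 1 (chartExtend n c θ) (Metric.ball z₀ r) := by
  intro z hzB
  refine ContDiffAt.contDiffWithinAt ?_
  by_cases hz : z ∈ interior (extChartAt (𝓡∂ n) c).target
  · refine ContDiffAt.congr_of_eventuallyEq ?_ (chartExtend_eventuallyEq c θ hz)
    exact ((hθ.contDiffOn c).contDiffAt (mem_interior_iff_mem_nhds.1 hz)).of_le (by simp)
  · exact contDiffAt_const.congr_of_eventuallyEq (chartExtend_eventuallyEq_zero c hθ hr hzB hz)

theorem measurable_chartExtend (c : M) {θ : M → ℝ} (hθ : IsTestFunction n θ) :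
    Measurable (chartExtend n c θ) := by
  classical
  have h : chartExtend n c θ = (extChartAt (𝓡∂ n) c).target.piecewise
      (fun z => θ ((extChartAt (𝓡∂ n) c).symm z)) (fun _ => 0) :=
    (piecewise_eq_indicator).symm
  rw [h]
  exact (hθ.contDiffOn c).continuousOn.measurable_piecewise continuousOn_const
    (measurableSet_extChartAt_target c)

variable [T2Space M] [CompactSpace M] [MeasurableSpace M] [BorelSpace M]

/-- On a set of coordinates where the weight of the chart and the Gram matrix are controlled, the
directional derivatives of a test function are controlled in `L¹` by its gradient. -/
theorem lintegral_fderiv_chartExtend_le (g : SmoothMetric n M) (c : M) {r : ℝ} {z₀ : RSpace n}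
    (hr : Metric.ball z₀ r ∩ range (𝓡∂ n) ⊆ (extChartAt (𝓡∂ n) c).target) {δ : ℝ} (hδ : 0 < δ)
    (hw : ∀ z ∈ Metric.ball z₀ r ∩ range (𝓡∂ n), δ ≤ Real.sqrt (gramMatrix g c z).det *
      chartPartition n M c ((extChartAt (𝓡∂ n) c).symm z)) (h : RSpace n) {C : ℝ} (hC : 0 ≤ C)
    (hCz : ∀ z ∈ Metric.ball z₀ r ∩ range (𝓡∂ n),
      g.inner ((extChartAt (𝓡∂ n) c).symm z) (coordVector c z h) (coordVector c z h) ≤ C ^ 2)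
    {θ : M → ℝ} (hθ : IsTestFunction n θ) :
    ∫⁻ z in Metric.ball z₀ r, ‖fderiv ℝ (chartExtend n c θ) z h‖ₑ ≤
      ENNReal.ofReal (C / δ) * ∫⁻ x, ENNReal.ofReal (fieldNorm g (grad g θ) x) ∂(riemVolume g) := by
  have hGm := (hθ.chartMeasurable_grad g).aemeasurable_fieldNorm.ennreal_ofReal
  have hGc : AEMeasurable (fun x => ENNReal.ofReal (fieldNorm g (grad g θ) x)) (chartVolume g c) := by
    have hG := hθ.chartMeasurable_grad g
    exact (aemeasurable_chartVolume g c (hG.aemeasurable_inner_chart hG c)).sqrt.ennreal_ofReal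
  calc ∫⁻ z in Metric.ball z₀ r, ‖fderiv ℝ (chartExtend n c θ) z h‖ₑ
      ≤ ∫⁻ z, (extChartAt (𝓡∂ n) c).target.indicator (fun z => ENNReal.ofReal (C / δ) *
          (ENNReal.ofReal (Real.sqrt (gramMatrix g c z).det) *
            (ENNReal.ofReal (chartPartition n M c ((extChartAt (𝓡∂ n) c).symm z)) *
            ENNReal.ofReal (fieldNorm g (grad g θ) ((extChartAt (𝓡∂ n) c).symm z))))) z := by
        rw [← lintegral_indicator Metric.isOpen_ball.measurableSet]
        refine lintegral_mono_ae ?_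
        filter_upwards [(ae_restrict_iff' (measurableSet_extChartAt_target c)).1
          (ae_mem_interior_target (n := n) c)] with z hz
        by_cases hzB : z ∈ Metric.ball z₀ r
        swap
        · rw [indicator_of_notMem hzB]; exact zero_le
        rw [indicator_of_mem hzB]
        by_cases hzi : z ∈ interior (extChartAt (𝓡∂ n) c).target
        swap
        · rw [(chartExtend_eventuallyEq_zero c hθ hr hzB hzi).fderiv_eq]
          simp
        have hzt := interior_subset hzi
        have hzBr : z ∈ Metric.ball z₀ r ∩ range (𝓡∂ n) :=
          ⟨hzB, extChartAt_target_subset_range c hzt⟩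
        rw [indicator_of_mem hzt, (chartExtend_eventuallyEq c θ hzi).fderiv_eq,
          ← inner_grad_coordVector g hθ c hzi h, Real.enorm_eq_ofReal_abs,
          ← ENNReal.ofReal_mul ((chartPartition n M).nonneg _ _),
          ← ENNReal.ofReal_mul (Real.sqrt_nonneg _), ← ENNReal.ofReal_mul (by positivity)]
        refine ENNReal.ofReal_le_ofReal ?_
        have hG := fieldNorm_nonneg g (grad g θ) ((extChartAt (𝓡∂ n) c).symm z)
        have h1 : |g.inner ((extChartAt (𝓡∂ n) c).symm z)
            (grad g θ ((extChartAt (𝓡∂ n) c).symm z)) (coordVector c z h)| ≤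
            fieldNorm g (grad g θ) ((extChartAt (𝓡∂ n) c).symm z) * C := by
          refine abs_le_of_sq_le_sq ?_ (mul_nonneg hG hC)
          refine (sq_inner_le g _ _ _).trans ?_
          rw [mul_pow, fieldNorm_sq]
          exact mul_le_mul_of_nonneg_left (hCz z hzBr) (metric_inner_self_nonneg g _ _)
        refine h1.trans ?_
        have h2 := mul_le_mul_of_nonneg_left (hw z hzBr)
          (div_nonneg (mul_nonneg hG hC) hδ.le)
        calc _ = fieldNorm g (grad g θ) ((extChartAt (𝓡∂ n) c).symm z) * C / δ * δ := by
              field_simp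
          _ ≤ _ := h2
          _ = _ := by ring
    _ = ENNReal.ofReal (C / δ) * ∫⁻ x, ENNReal.ofReal (chartPartition n M c x) *
          ENNReal.ofReal (fieldNorm g (grad g θ) x) ∂(chartVolume g c) := by
        rw [lintegral_indicator (measurableSet_extChartAt_target c),
          lintegral_const_mul' _ _ ENNReal.ofReal_ne_top]
        congr 1
        exact (lintegral_chartVolume g c
          ((measurable_partition (n := n) c).aemeasurable.mul hGc)).symm
    _ = ENNReal.ofReal (C / δ) * ∫⁻ x, ENNReal.ofReal (fieldNorm g (grad g θ) x)
          ∂((chartVolume g c).withDensity (fun x => ENNReal.ofReal (chartPartition n M c x))) := by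
        rw [lintegral_withDensity_eq_lintegral_mul_non_measurable _ (measurable_partition c)
          (ae_of_all _ fun _ => ENNReal.ofReal_lt_top)]
        rfl
    _ ≤ _ := by
        gcongr
        exact withDensity_chartVolume_le g c

end Propagation

/-! ### The qualitative Poincaré inequality -/

section Poincare

variable {n : ℕ} [NeZero n] {M : Type*} [TopologicalSpace M]
  [ChartedSpace (EuclideanHalfSpace n) M] [IsManifold (𝓡∂ n) ∞ M]
  [T2Space M] [CompactSpace M] [MeasurableSpace M] [BorelSpace M]

/-- Every point lies in the domain of a chart in which it has a ball of coordinates on which the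
weight of the chart in the Riemannian measure is bounded below. -/
theorem exists_good_ball (g : SmoothMetric n M) (x : M) : ∃ c : M,
    x ∈ (extChartAt (𝓡∂ n) c).source ∧ ∃ r > 0, ∃ δ > 0,
      Metric.closedBall (extChartAt (𝓡∂ n) c x) r ∩ range (𝓡∂ n) ⊆ (extChartAt (𝓡∂ n) c).target ∧
      ∀ z ∈ Metric.closedBall (extChartAt (𝓡∂ n) c x) r ∩ range (𝓡∂ n),
        δ ≤ Real.sqrt (gramMatrix g c z).det *
          chartPartition n M c ((extChartAt (𝓡∂ n) c).symm z) := by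
  obtain ⟨c, hc⟩ := (chartPartition n M).exists_pos_of_mem (mem_univ x)
  have hxc : x ∈ (extChartAt (𝓡∂ n) c).source :=
    tsupport_partition_subset c (subset_tsupport _ hc.ne')
  have hzt := (extChartAt (𝓡∂ n) c).map_source hxc
  have hcont : ContinuousOn (fun z => Real.sqrt (gramMatrix g c z).det *
      chartPartition n M c ((extChartAt (𝓡∂ n) c).symm z)) (extChartAt (𝓡∂ n) c).target :=
    (continuousOn_sqrt_det_gramMatrix g c).mul
      ((chartPartition n M c).contMDiff.continuous.comp_continuousOn
        (continuousOn_extChartAt_symm c))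
  have hpos : 0 < Real.sqrt (gramMatrix g c (extChartAt (𝓡∂ n) c x)).det *
      chartPartition n M c ((extChartAt (𝓡∂ n) c).symm (extChartAt (𝓡∂ n) c x)) := by
    rw [(extChartAt (𝓡∂ n) c).left_inv hxc]
    exact mul_pos (Real.sqrt_pos.2 (gramMatrix_det_pos g c hzt)) hc
  have hnhds : (extChartAt (𝓡∂ n) c).target ∈ 𝓝[range (𝓡∂ n)] (extChartAt (𝓡∂ n) c x) :=
    extChartAt_target_mem_nhdsWithin_of_mem hzt
  have hev := ((hcont _ hzt).mono_of_mem_nhdsWithin hnhds).eventually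
    (eventually_gt_nhds (half_lt_self hpos))
  have hset := (nhdsWithin_hasBasis Metric.nhds_basis_closedBall (range (𝓡∂ n))).mem_iff.1
    (hev.and hnhds)
  obtain ⟨r, hr, hsub⟩ := hset
  exact ⟨c, hxc, r, hr, _, half_pos hpos, fun z hz => (hsub hz).2, fun z hz => (hsub hz).1.le⟩

/-- Around every point there is an open set in which the convergence to zero of a sequence of test
functions, with gradients summable in `L¹`, propagates from any nonempty open subset. Around a
boundary point the convergence holds unconditionally, as the extensions by zero of test functions
vanish beyond the boundary. -/
theorem exists_propagation_nhds (g : SmoothMetric n M) {θ : ℕ → M → ℝ}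
    (hθ : ∀ m, IsTestFunction n (θ m))
    (hsum : ∑' m, ∫⁻ x, ENNReal.ofReal (fieldNorm g (grad g (θ m)) x) ∂(riemVolume g) ≠ ⊤)
    (x : M) : ∃ U : Set M, IsOpen U ∧ x ∈ U ∧
      (∀ V ⊆ U, IsOpen V → V.Nonempty →
        AEOn n V (fun y => Tendsto (fun m => θ m y) atTop (𝓝 0)) →
        AEOn n U (fun y => Tendsto (fun m => θ m y) atTop (𝓝 0))) ∧
      (x ∉ (𝓡∂ n).interior M → AEOn n U (fun y => Tendsto (fun m => θ m y) atTop (𝓝 0))) := by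
  obtain ⟨c, hxc, r, hr, δ, hδ, hsub, hw⟩ := exists_good_ball g x
  set z₀ := extChartAt (𝓡∂ n) c x with hz₀
  have hball : Metric.ball z₀ r ∩ range (𝓡∂ n) ⊆ Metric.closedBall z₀ r ∩ range (𝓡∂ n) :=
    inter_subset_inter_left _ Metric.ball_subset_closedBall
  have hsub' := hball.trans hsub
  have hK : IsCompact (Metric.closedBall z₀ r ∩ range (𝓡∂ n)) :=
    (isCompact_closedBall z₀ r).inter_right (𝓡∂ n).isClosed_range
  set ψ : ℕ → RSpace n → ℝ := fun m => chartExtend n c (θ m) with hψ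
  have hψsum : ∀ h : RSpace n,
      ∑' m, ∫⁻ z in Metric.ball z₀ r, ‖fderiv ℝ (ψ m) z h‖ₑ ∂volume ≠ ⊤ := by
    intro h
    obtain ⟨C, hC⟩ := hK.exists_bound_of_continuousOn
      ((continuousOn_inner_coordVector g c h h).mono hsub)
    have hCz : ∀ z ∈ Metric.ball z₀ r ∩ range (𝓡∂ n),
        g.inner ((extChartAt (𝓡∂ n) c).symm z) (coordVector c z h) (coordVector c z h) ≤
          Real.sqrt (max C 0) ^ 2 := by
      intro z hz
      rw [Real.sq_sqrt (le_max_right _ _)]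
      exact ((le_abs_self _).trans (hC z (hball hz))).trans (le_max_left _ _)
    have hle := fun m => lintegral_fderiv_chartExtend_le g c hsub' hδ
      (fun z hz => hw z (hball hz)) h (Real.sqrt_nonneg _) hCz (hθ m)
    refine ne_top_of_le_ne_top ?_ (ENNReal.tsum_le_tsum hle)
    rw [ENNReal.tsum_mul_left]
    exact ENNReal.mul_ne_top ENNReal.ofReal_ne_top hsum
  have hdich := measure_tendsto_zero_dichotomy volume Metric.isOpen_ball (convex_ball z₀ r)
    (fun m => measurable_chartExtend c (hθ m)) (fun m => contDiffOn_chartExtend c (hθ m) hsub')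
    hψsum
  let U : Set M := (extChartAt (𝓡∂ n) c).source ∩ extChartAt (𝓡∂ n) c ⁻¹' Metric.ball z₀ r
  have hUo : IsOpen U := (continuousOn_extChartAt c).isOpen_inter_preimage
    (isOpen_extChartAt_source c) Metric.isOpen_ball
  have hext : ∀ z ∈ (extChartAt (𝓡∂ n) c).target, ∀ m,
      ψ m z = θ m ((extChartAt (𝓡∂ n) c).symm z) := fun z hz m => indicator_of_mem hz _
  have hconc : volume {z ∈ Metric.ball z₀ r | Tendsto (fun m => ψ m z) atTop (𝓝 0)} ≠ 0 →
      AEOn n U (fun y => Tendsto (fun m => θ m y) atTop (𝓝 0)) := by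
    intro hne
    have h0 := hdich.resolve_left hne
    refine AEOn.of_chart (c := c) inter_subset_left ?_
    rw [ae_restrict_iff' (measurableSet_extChartAt_target c)]
    filter_upwards [measure_eq_zero_iff_ae_notMem.1 h0] with z hz hzt hzU
    have hzB : z ∈ Metric.ball z₀ r := by
      have := hzU.2
      rwa [mem_preimage, (extChartAt (𝓡∂ n) c).right_inv hzt] at this
    by_contra hcon
    refine hz ⟨hzB, ?_⟩
    rwa [← funext (hext z hzt)] at hcon
  refine ⟨U, hUo, ⟨hxc, Metric.mem_ball_self hr⟩, ?_, ?_⟩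
  · intro V hVU hVo ⟨y, hy⟩ hV
    refine hconc ?_
    have hpos := volume_preimage_pos_of_isOpen hVo hy (hVU hy).1
    refine (hpos.trans_le (measure_mono_ae ?_)).ne'
    filter_upwards [(ae_restrict_iff' (measurableSet_extChartAt_target c)).1 (hV c)] with z hz hzO
    have hzt := interior_subset hzO.1
    have hzB := (hVU hzO.2).2
    rw [mem_preimage, (extChartAt (𝓡∂ n) c).right_inv hzt] at hzB
    refine ⟨hzB, ?_⟩
    simpa only [hext z hzt] using hz hzt hzO.2
  · intro hx
    refine hconc ?_
    have hO : IsOpen (Metric.ball z₀ r ∩ (range (𝓡∂ n))ᶜ) :=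
      Metric.isOpen_ball.inter (𝓡∂ n).isClosed_range.isOpen_compl
    have hz₀i : z₀ ∉ interior (range (𝓡∂ n)) := fun h =>
      hx ((mem_interior_iff_of_mem_source c hxc).2 (mem_interior_target_of_mem_interior_range c
        ((extChartAt (𝓡∂ n) c).map_source hxc) h))
    have hcl : z₀ ∈ closure (range (𝓡∂ n))ᶜ := by rwa [closure_compl]
    have hpos := hO.measure_pos volume
      (mem_closure_iff.1 hcl _ Metric.isOpen_ball (Metric.mem_ball_self hr))
    refine (hpos.trans_le (measure_mono ?_)).ne'
    intro z hz
    refine ⟨hz.1, ?_⟩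
    have h0 : ∀ m, ψ m z = 0 := fun m => indicator_of_notMem
      (fun h => hz.2 (extChartAt_target_subset_range c h)) _
    simp only [h0]
    exact tendsto_const_nhds

/-- **Qualitative Poincaré inequality.** If every connected component of `M` meets the boundary,
a sequence of test functions whose gradients are summable in `L¹` tends to zero almost everywhere. -/
theorem ae_tendsto_zero_of_summable_grad (g : SmoothMetric n M)
    (hbd : ∀ x : M, ∃ y ∈ (𝓡∂ n).boundary M, y ∈ connectedComponent x) {θ : ℕ → M → ℝ}
    (hθ : ∀ m, IsTestFunction n (θ m))
    (hsum : ∑' m, ∫⁻ x, ENNReal.ofReal (fieldNorm g (grad g (θ m)) x) ∂(riemVolume g) ≠ ⊤) :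
    ∀ᵐ x ∂(riemVolume g), Tendsto (fun m => θ m x) atTop (𝓝 0) := by
  let O : Set M := {x | ∃ U : Set M, IsOpen U ∧ x ∈ U ∧
    AEOn n U (fun y => Tendsto (fun m => θ m y) atTop (𝓝 0))}
  have hOo : IsOpen O := isOpen_iff_forall_mem_open.2 fun x ⟨U, hU, hxU, hT⟩ =>
    ⟨U, fun y hy => ⟨U, hU, hy, hT⟩, hU, hxU⟩
  have hOc : IsClosed O := by
    refine isClosed_of_closure_subset fun x hx => ?_
    obtain ⟨U, hU, hxU, hprop, -⟩ := exists_propagation_nhds g hθ hsum x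
    obtain ⟨y, hyU, W, hW, hyW, hT⟩ := mem_closure_iff.1 hx U hU hxU
    exact ⟨U, hU, hxU, hprop (U ∩ W) inter_subset_left (hU.inter hW) ⟨y, hyU, hyW⟩
      (hT.mono inter_subset_right)⟩
  have hall : ∀ x, x ∈ O := by
    intro x
    obtain ⟨y, hyb, hyx⟩ := hbd x
    have hyO : y ∈ O := by
      obtain ⟨U, hU, hyU, -, hb⟩ := exists_propagation_nhds g hθ hsum y
      refine ⟨U, hU, hyU, hb ?_⟩
      rw [← (𝓡∂ n).compl_interior] at hyb
      exact hyb
    have h := (show IsClopen O from ⟨hOc, hOo⟩).connectedComponent_subset hyO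
    rw [← connectedComponent_eq hyx] at h
    exact h mem_connectedComponent
  choose U hU hxU hT using hall
  obtain ⟨t, ht⟩ := isCompact_univ.elim_finite_subcover U hU
    (fun x _ => mem_iUnion.2 ⟨x, hxU x⟩)
  refine ae_riemVolume_of_charts g fun c => ?_
  have := (ae_ball_iff (t.countable_toSet)).2 fun y (_ : y ∈ (t : Set M)) => hT y c
  filter_upwards [this] with z hz
  obtain ⟨y, hyt, hy⟩ := mem_iUnion₂.1 (ht (mem_univ ((extChartAt (𝓡∂ n) c).symm z)))
  exact hz y hyt hy

end Poincare

/-! ### Smooth truncations and approximation by test functions -/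

section RealFunctions

/-- A smooth bounded version of the truncation `T_k`: it is the identity on `[-k, k]` and is
constant on each side beyond `k + 1`. -/
theorem exists_smooth_trunc {k : ℝ} (hk : 0 < k) : ∃ S : ℝ → ℝ, ContDiff ℝ ∞ S ∧
    (∃ B : ℝ, ∀ s, |S s| ≤ B) ∧ (∀ s, |deriv S s| ≤ 1) ∧ (∀ s, |s| ≤ k → S s = s) ∧
    (∀ s, |s| ≤ k → deriv S s = 1) ∧ (∀ s, k + 1 ≤ |s| → deriv S s = 0) ∧
    ∀ s, S s = 0 → s = 0 := by
  let ρ : ContDiffBump (0 : ℝ) := ⟨k, k + 1, hk, by linarith⟩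
  have hρc : Continuous ρ := ρ.continuous
  let S : ℝ → ℝ := fun s => ∫ t in (0 : ℝ)..s, ρ t
  have hd : ∀ s, HasDerivAt S (ρ s) s := fun s =>
    intervalIntegral.integral_hasDerivAt_right (hρc.intervalIntegrable _ _)
      hρc.aestronglyMeasurable.stronglyMeasurableAtFilter hρc.continuousAt
  have hderiv : deriv S = ρ := funext fun s => (hd s).deriv
  have hid : ∀ s, |s| ≤ k → S s = s := by
    intro s hs
    have h1 : ∫ t in (0 : ℝ)..s, ρ t = ∫ t in (0 : ℝ)..s, (1 : ℝ) := by
      refine intervalIntegral.integral_congr fun t ht => ?_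
      refine ρ.one_of_mem_closedBall ?_
      rw [mem_closedBall_zero_iff, Real.norm_eq_abs]
      have : |t| ≤ |s| := by
        rcases mem_uIcc.1 ht with h | h
        · rw [abs_of_nonneg h.1, abs_of_nonneg (h.1.trans h.2)]; exact h.2
        · rw [abs_of_nonpos h.2, abs_of_nonpos (h.1.trans h.2)]; linarith [h.1]
      exact this.trans hs
    simpa using h1
  have hmono : Monotone S := monotone_of_deriv_nonneg (fun s => (hd s).differentiableAt)
    fun s => by rw [hderiv]; exact ρ.nonneg
  refine ⟨S, ?_, ⟨∫ t, ρ t, fun s => ?_⟩, fun s => ?_, hid, fun s hs => ?_, fun s hs => ?_,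
    fun s hs => ?_⟩
  · rw [contDiff_infty_iff_deriv]
    exact ⟨fun s => (hd s).differentiableAt, by rw [hderiv]; exact ρ.contDiff⟩
  · have hint : Integrable ρ := hρc.integrable_of_hasCompactSupport ρ.hasCompactSupport
    refine (intervalIntegral.norm_integral_le_integral_norm_uIoc (f := ρ) (a := 0) (b := s)
      (μ := volume)).trans ?_
    simp only [Real.norm_of_nonneg ρ.nonneg]
    exact setIntegral_le_integral hint (ae_of_all _ fun t => ρ.nonneg)
  · rw [hderiv, abs_of_nonneg ρ.nonneg]; exact ρ.le_one
  · rw [hderiv]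
    exact ρ.one_of_mem_closedBall (by rwa [mem_closedBall_zero_iff, Real.norm_eq_abs])
  · rw [hderiv]
    exact ρ.zero_of_le_dist (by rwa [dist_zero_right, Real.norm_eq_abs])
  · by_contra hne
    have hk' : |k| ≤ k := (abs_of_pos hk).le
    have hnk' : |(-k)| ≤ k := by rw [abs_neg]; exact hk'
    rcases le_or_gt |s| k with h | h
    · exact hne ((hid s h).symm.trans hs)
    · rcases lt_abs.1 h with h | h
      · have := hmono h.le
        rw [hid k hk', hs] at this
        linarith
      · have := hmono (show s ≤ -k by linarith)
        rw [hid (-k) hnk', hs] at this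
        linarith

end RealFunctions

section Dominated

variable {α : Type*} [MeasurableSpace α] {μ : Measure α}

/-- Dominated convergence in `L^p`. -/
theorem tendsto_eLpNorm_zero_of_dominated {p : ℝ} (hp : 0 < p) {F : ℕ → α → ℝ} {b : α → ℝ}
    (hF : ∀ m, AEMeasurable (F m) μ) (hb : MemLp b (ENNReal.ofReal p) μ)
    (hFb : ∀ m, ∀ᵐ x ∂μ, |F m x| ≤ b x) (hlim : ∀ᵐ x ∂μ, Tendsto (fun m => F m x) atTop (𝓝 0)) :
    Tendsto (fun m => eLpNorm (F m) (ENNReal.ofReal p) μ) atTop (𝓝 0) := by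
  have hp0 : ENNReal.ofReal p ≠ 0 := by simpa using hp
  have hpt : ENNReal.ofReal p ≠ ⊤ := ENNReal.ofReal_ne_top
  simp only [eLpNorm_eq_lintegral_rpow_enorm_toReal hp0 hpt, ENNReal.toReal_ofReal hp.le]
  have h1 : Tendsto (fun m => ∫⁻ x, ‖F m x‖ₑ ^ p ∂μ) atTop (𝓝 (∫⁻ _, 0 ∂μ)) := by
    refine tendsto_lintegral_of_dominated_convergence' (fun x => ‖b x‖ₑ ^ p)
      (fun m => (hF m).enorm.pow_const p) (fun m => ?_) ?_ ?_
    · filter_upwards [hFb m] with x hx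
      refine ENNReal.rpow_le_rpow ?_ hp.le
      rw [Real.enorm_eq_ofReal_abs, Real.enorm_eq_ofReal_abs]
      exact ENNReal.ofReal_le_ofReal (hx.trans (le_abs_self _))
    · have := lintegral_rpow_enorm_lt_top_of_eLpNorm_lt_top hp0 hpt hb.2
      rw [ENNReal.toReal_ofReal hp.le] at this
      exact this.ne
    · filter_upwards [hlim] with x hx
      have h2 := ((tendsto_zero_iff_enorm_tendsto_zero).1 hx).ennrpow_const p
      rwa [ENNReal.zero_rpow_of_pos hp] at h2
  rw [lintegral_zero] at h1
  have h3 := h1.ennrpow_const (1 / p)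
  rwa [ENNReal.zero_rpow_of_pos (by positivity)] at h3

end Dominated

section TestFunctions

variable {n : ℕ} [NeZero n] {M : Type*} [TopologicalSpace M]
  [ChartedSpace (EuclideanHalfSpace n) M] [IsManifold (𝓡∂ n) ∞ M]

theorem IsTestFunction.sub {θ η : M → ℝ} (hθ : IsTestFunction n θ) (hη : IsTestFunction n η) :
    IsTestFunction n (θ - η) := by
  refine ⟨hθ.1.sub hη.1, hθ.2.1.sub hη.2.1, ?_⟩
  exact (tsupport_sub θ η).trans (union_subset hθ.2.2 hη.2.2)

theorem IsTestFunction.comp {θ : M → ℝ} (hθ : IsTestFunction n θ) {S : ℝ → ℝ}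
    (hS : ContDiff ℝ ∞ S) (hS0 : S 0 = 0) : IsTestFunction n (S ∘ θ) := by
  refine ⟨hS.contMDiff.comp hθ.1, hθ.2.1.comp_left hS0, ?_⟩
  exact (closure_mono (Function.support_comp_subset hS0 θ)).trans hθ.2.2

theorem eq_of_inner_eq (g : SmoothMetric n M) {x : M} {v w : TangentSpace (𝓡∂ n) x}
    (h : ∀ e, g.inner x v e = g.inner x w e) : v = w := by
  by_contra hne
  refine (g.pos x _ (sub_ne_zero.2 hne)).ne' ?_
  rw [(g.inner x).map_sub v w, sub_apply, h, sub_self]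

theorem grad_sub (g : SmoothMetric n M) {θ η : M → ℝ} (hθ : IsTestFunction n θ)
    (hη : IsTestFunction n η) : grad g (θ - η) = grad g θ - grad g η := by
  ext1 x
  have h1 : MDifferentiableAt (𝓡∂ n) 𝓘(ℝ, ℝ) θ x := hθ.1.mdifferentiableAt (by simp)
  have h2 : MDifferentiableAt (𝓡∂ n) 𝓘(ℝ, ℝ) η x := hη.1.mdifferentiableAt (by simp)
  refine eq_of_inner_eq g fun e => ?_
  rw [Pi.sub_apply, map_sub, sub_apply, inner_grad, inner_grad, inner_grad,
    (h1.hasMFDerivAt.sub h2.hasMFDerivAt).mfderiv]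
  rfl

theorem grad_comp (g : SmoothMetric n M) {θ : M → ℝ} (hθ : IsTestFunction n θ) {S : ℝ → ℝ}
    (hS : ContDiff ℝ ∞ S) : grad g (S ∘ θ) = fun x => deriv S (θ x) • grad g θ x := by
  ext1 x
  have h1 : MDifferentiableAt (𝓡∂ n) 𝓘(ℝ, ℝ) θ x := hθ.1.mdifferentiableAt (by simp)
  have h2 : MDifferentiableAt 𝓘(ℝ, ℝ) 𝓘(ℝ, ℝ) S (θ x) :=
    (hS.differentiable (by simp) _).mdifferentiableAt
  refine eq_of_inner_eq g fun e => ?_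
  rw [map_smul, smul_apply, inner_grad, inner_grad, mfderiv_comp x h2 h1, mfderiv_eq_fderiv]
  have h3 : ∀ y : ℝ, fderiv ℝ S (θ x) y = deriv S (θ x) * y := fun y => by
    rw [fderiv_eq_smul_deriv, smul_eq_mul, mul_comm]
  exact h3 _

variable [T2Space M] [CompactSpace M] [MeasurableSpace M] [BorelSpace M]

theorem IsTestFunction.measurable {θ : M → ℝ} (hθ : IsTestFunction n θ) : Measurable θ :=
  hθ.1.continuous.measurable

/-- Compositions with smooth bounded functions preserve approximability by test functions, and
improve a convergence in measure to a convergence in `L^p`. -/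
theorem exists_test_approx_comp (g : SmoothMetric n M) {p : ℝ} (hp : 1 ≤ p) {θ : ℕ → M → ℝ}
    (hθ : ∀ m, IsTestFunction n (θ m)) {w : M → ℝ} (hw : TendstoInMeasure (riemVolume g) θ atTop w)
    {W : VField n M} (hW : ChartMeasurable g W)
    (hWp : MemLp (fieldNorm g W) (ENNReal.ofReal p) (riemVolume g))
    (hlim : Tendsto (fun m => eLpNorm (fieldNorm g (grad g (θ m) - W)) (ENNReal.ofReal p)
      (riemVolume g)) atTop (𝓝 0))
    {S : ℝ → ℝ} (hS : ContDiff ℝ ∞ S) (hS0 : S 0 = 0) {B : ℝ} (hB : ∀ s, |S s| ≤ B)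
    (hS1 : ∀ s, |deriv S s| ≤ 1) :
    ∃ φ : ℕ → M → ℝ, (∀ m, IsTestFunction n (φ m)) ∧
      Tendsto (fun m => eLpNorm (φ m - fun x => S (w x)) (ENNReal.ofReal p) (riemVolume g))
        atTop (𝓝 0) ∧
      Tendsto (fun m => eLpNorm (fieldNorm g (grad g (φ m) - fun x => deriv S (w x) • W x))
        (ENNReal.ofReal p) (riemVolume g)) atTop (𝓝 0) := by
  have hp0 : 0 < p := by linarith
  obtain ⟨ns, hns, hae⟩ := hw.exists_seq_tendsto_ae
  have hwm : AEMeasurable w (riemVolume g) :=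
    aemeasurable_of_tendsto_metrizable_ae _ (fun m => (hθ (ns m)).measurable.aemeasurable) hae
  have hS'c : Continuous (deriv S) := hS.continuous_deriv (by simp)
  have hSw : AEMeasurable (fun x => S (w x)) (riemVolume g) :=
    hS.continuous.measurable.comp_aemeasurable hwm
  have hS'w : AEMeasurable (fun x => deriv S (w x)) (riemVolume g) :=
    hS'c.measurable.comp_aemeasurable hwm
  refine ⟨fun m => S ∘ θ (ns m), fun m => (hθ _).comp hS hS0, ?_, ?_⟩
  · refine tendsto_eLpNorm_zero_of_dominated hp0 (b := fun _ => B + B)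
      (fun m => ((hS.continuous.measurable.comp (hθ _).measurable).aemeasurable).sub hSw)
      (memLp_const _) (fun m => ae_of_all _ fun x => ?_) ?_
    · exact (abs_sub _ _).trans (add_le_add (hB _) (hB _))
    · filter_upwards [hae] with x hx
      have := ((hS.continuous.tendsto _).comp hx).sub_const (S (w x))
      simpa using this
  · have h1 : Tendsto (fun m => eLpNorm (fun x => (deriv S (θ (ns m) x) - deriv S (w x)) *
        fieldNorm g W x) (ENNReal.ofReal p) (riemVolume g)) atTop (𝓝 0) := by
      refine tendsto_eLpNorm_zero_of_dominated hp0 (b := fun x => 2 * fieldNorm g W x)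
        (fun m => (((hS'c.measurable.comp (hθ _).measurable).aemeasurable).sub hS'w).mul
          hW.aemeasurable_fieldNorm)
        (hWp.const_mul 2) (fun m => ae_of_all _ fun x => ?_) ?_
      · rw [abs_mul, abs_of_nonneg (fieldNorm_nonneg g W x)]
        refine mul_le_mul_of_nonneg_right ?_ (fieldNorm_nonneg g W x)
        refine (abs_sub _ _).trans ?_
        linarith [hS1 (θ (ns m) x), hS1 (w x)]
      · filter_upwards [hae] with x hx
        have := (((hS'c.tendsto _).comp hx).sub_const (deriv S (w x))).mul_const (fieldNorm g W x)
        simpa using this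
    have h2 := (hlim.comp hns.tendsto_atTop).add h1
    rw [add_zero] at h2
    refine tendsto_of_tendsto_of_tendsto_of_le_of_le tendsto_const_nhds h2 (fun _ => zero_le)
      fun m => ?_
    have hp1 : (1 : ℝ≥0∞) ≤ ENNReal.ofReal p := by simpa using hp
    refine (eLpNorm_mono_real (g := fun x => fieldNorm g (grad g (θ (ns m)) - W) x +
      |(deriv S (θ (ns m) x) - deriv S (w x)) * fieldNorm g W x|) fun x => ?_).trans
      ((eLpNorm_add_le ?_ ?_ hp1).trans (add_le_add le_rfl ?_))
    · rw [Real.norm_of_nonneg (fieldNorm_nonneg _ _ _), abs_mul,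
        abs_of_nonneg (fieldNorm_nonneg g W x), ← fieldNorm_smul g
          (fun x => deriv S (θ (ns m) x) - deriv S (w x)) W x]
      have h3 : fieldNorm g (grad g (S ∘ θ (ns m)) - fun x => deriv S (w x) • W x) x =
          fieldNorm g ((fun x => deriv S (θ (ns m) x) • (grad g (θ (ns m)) - W) x) +
            fun x => (deriv S (θ (ns m) x) - deriv S (w x)) • W x) x := by
        refine fieldNorm_congr g ?_
        rw [grad_comp g (hθ _) hS]
        simp only [Pi.sub_apply, Pi.add_apply, smul_sub, sub_smul]
        abel
      rw [h3]
      refine (fieldNorm_add_le g _ _ x).trans (add_le_add ?_ le_rfl)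
      rw [fieldNorm_smul]
      exact mul_le_of_le_one_left (fieldNorm_nonneg _ _ _) (hS1 _)
    · exact (((hθ _).chartMeasurable_grad g).sub hW).aemeasurable_fieldNorm.aestronglyMeasurable
    · exact ((((hS'c.measurable.comp (hθ _).measurable).aemeasurable.sub hS'w).mul
        hW.aemeasurable_fieldNorm)).abs.aestronglyMeasurable
    · exact (eLpNorm_norm (fun x => (deriv S (θ (ns m) x) - deriv S (w x)) * fieldNorm g W x)).le

end TestFunctions

/-! ### Truncations of functions in the energy space -/

section Trunc

theorem abs_trunc_le {k : ℝ} (hk : 0 ≤ k) (s : ℝ) : |trunc k s| ≤ k :=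
  abs_le.2 ⟨le_max_left _ _, max_le (by linarith) (min_le_right _ _)⟩

theorem trunc_of_abs_le {k s : ℝ} (h : |s| ≤ k) : trunc k s = s := by
  rw [trunc, min_eq_left (abs_le.1 h).2, max_eq_right (abs_le.1 h).1]

theorem trunc_of_le {k s : ℝ} (hk : 0 ≤ k) (h : k ≤ s) : trunc k s = k := by
  rw [trunc, min_eq_right h, max_eq_right (by linarith)]

theorem trunc_of_le_neg {k s : ℝ} (h : s ≤ -k) : trunc k s = -k := by
  rw [trunc, max_eq_left ((min_le_left _ _).trans h)]

theorem continuous_trunc (k : ℝ) : Continuous (trunc k) :=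
  continuous_const.max (continuous_id.min continuous_const)

theorem trunc_neg (k s : ℝ) (hk : 0 ≤ k) : trunc k (-s) = -trunc k s := by
  rcases le_or_gt |s| k with h | h
  · rw [trunc_of_abs_le h, trunc_of_abs_le (by rwa [abs_neg])]
  · rcases lt_abs.1 h with h | h
    · rw [trunc_of_le hk h.le, trunc_of_le_neg (by linarith)]
    · rw [trunc_of_le hk h.le, trunc_of_le_neg (by linarith), neg_neg]

end Trunc

section Truncations

variable {n : ℕ} [NeZero n] {M : Type*} [TopologicalSpace M]
  [ChartedSpace (EuclideanHalfSpace n) M] [IsManifold (𝓡∂ n) ∞ M]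
  [T2Space M] [CompactSpace M]

/-- The interior of `M` is exhausted by a sequence of compact sets. -/
theorem exists_compact_exhaustion_interior : ∃ K : ℕ → Set M, Monotone K ∧
    (∀ j, IsCompact (K j)) ∧ (∀ j, K j ⊆ (𝓡∂ n).interior M) ∧ ⋃ j, K j = (𝓡∂ n).interior M := by
  have hopen : IsOpen ((𝓡∂ n).interior M) := (𝓡∂ n).isOpen_interior (n := ∞) (by simp)
  have : SecondCountableTopology (EuclideanHalfSpace n) :=
    inferInstanceAs (SecondCountableTopology {x : EuclideanSpace ℝ (Fin n) // 0 ≤ x 0})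
  have : SecondCountableTopology M :=
    ChartedSpace.secondCountable_of_sigmaCompact (EuclideanHalfSpace n) M
  have : LocallyCompactSpace ((𝓡∂ n).interior M) := hopen.locallyCompactSpace
  refine ⟨fun j => Subtype.val '' compactCovering ((𝓡∂ n).interior M) j,
    fun i j hij => image_mono (compactCovering_subset _ hij),
    fun j => (isCompact_compactCovering _ j).image continuous_subtype_val, fun j => ?_, ?_⟩
  · rintro _ ⟨x, -, rfl⟩
    exact x.2
  · rw [← image_iUnion, iUnion_compactCovering, image_univ, Subtype.range_coe]

variable [MeasurableSpace M] [BorelSpace M]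

/-- Convergence in `L¹_loc` of the interior implies convergence in measure on `M`, as the boundary
is a null set. -/
theorem tendstoInMeasure_of_tendsto_L1_loc (g : SmoothMetric n M) {θ : ℕ → M → ℝ} {w : M → ℝ}
    (hθ : ∀ m, Measurable (θ m)) (hw : AEMeasurable w (riemVolume g))
    (h : ∀ K : Set M, IsCompact K → K ⊆ (𝓡∂ n).interior M →
        Tendsto (fun m => ∫⁻ x in K, ‖θ m x - w x‖ₑ ∂(riemVolume g)) atTop (𝓝 0)) :
    TendstoInMeasure (riemVolume g) θ atTop w := by
  obtain ⟨K, hKmono, hKc, hKi, hKU⟩ := exists_compact_exhaustion_interior (n := n) (M := M)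
  have hcompl : Tendsto (fun j => riemVolume g (K j)ᶜ) atTop (𝓝 0) := by
    have h1 := tendsto_measure_iInter_atTop (μ := riemVolume g) (s := fun j => (K j)ᶜ)
      (fun j => (hKc j).measurableSet.compl.nullMeasurableSet)
      (fun i j hij => compl_subset_compl.2 (hKmono hij)) ⟨0, measure_ne_top _ _⟩
    rw [← compl_iUnion, hKU, measure_eq_zero_iff_ae_notMem.2] at h1
    · exact h1
    · filter_upwards [ae_mem_interior g] with x hx hx'
      exact hx' hx
  refine tendstoInMeasure_of_ne_top fun ε hε hεt => ?_
  rw [ENNReal.tendsto_nhds_zero]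
  intro η hη
  have hη2 : 0 < η / 2 := ENNReal.half_pos hη.ne'
  obtain ⟨j, hj⟩ := ((ENNReal.tendsto_nhds_zero.1 hcompl) _ hη2).exists
  have hK := h (K j) (hKc j) (hKi j)
  have hmul : Tendsto (fun m => ε⁻¹ * ∫⁻ x in K j, ‖θ m x - w x‖ₑ ∂(riemVolume g)) atTop (𝓝 0) := by
    have := ENNReal.Tendsto.const_mul (a := ε⁻¹) hK (Or.inr (ENNReal.inv_ne_top.2 hε.ne'))
    rwa [mul_zero] at this
  filter_upwards [(ENNReal.tendsto_nhds_zero.1 hmul) _ hη2] with m hm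
  have hmark : (riemVolume g).restrict (K j) {x | ε ≤ edist (θ m x) (w x)} ≤
      ε⁻¹ * ∫⁻ x in K j, ‖θ m x - w x‖ₑ ∂(riemVolume g) := by
    have h2 := mul_meas_ge_le_lintegral₀ (μ := (riemVolume g).restrict (K j))
      (((hθ m).aemeasurable.sub hw).enorm.mono_measure Measure.restrict_le_self) ε
    rw [← ENNReal.div_eq_inv_mul, ENNReal.le_div_iff_mul_le (Or.inl hε.ne') (Or.inl hεt), mul_comm]
    simpa only [edist_eq_enorm_sub, Pi.sub_apply] using h2
  calc riemVolume g {x | ε ≤ edist (θ m x) (w x)}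
      ≤ riemVolume g ({x | ε ≤ edist (θ m x) (w x)} ∩ K j) + riemVolume g (K j)ᶜ := by
        refine (measure_mono fun x hx => ?_).trans (measure_union_le _ _)
        by_cases hxK : x ∈ K j
        · exact Or.inl ⟨hx, hxK⟩
        · exact Or.inr hxK
    _ ≤ η / 2 + η / 2 := by
        refine add_le_add ?_ hj
        rw [← Measure.restrict_apply' (hKc j).measurableSet]
        exact hmark.trans hm
    _ = η := ENNReal.add_halves η

variable {g : SmoothMetric n M} {p : ℝ} {u : M → ℝ} {V : VField n M}

theorem IsGenGradient.chartMeasurable_cutField (hV : IsGenGradient g u V) {k : ℝ} (hk : 0 < k) :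
    ChartMeasurable g (cutField u k V) :=
  ChartMeasurable.of_hasWeakGradient (hV k hk)

/-- The generalized gradient is the pointwise limit of its cut-offs. -/
theorem IsGenGradient.chartMeasurable (hV : IsGenGradient g u V) : ChartMeasurable g V := by
  intro c e
  refine aemeasurable_of_tendsto_metrizable_ae atTop
    (fun j : ℕ => hV.chartMeasurable_cutField (k := (j : ℝ) + 1) (by positivity) c e)
    (ae_of_all _ fun z => ?_)
  refine tendsto_const_nhds.congr' ?_
  filter_upwards [eventually_ge_atTop ⌈|u ((extChartAt (𝓡∂ n) c).symm z)|⌉₊] with j hj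
  have h1 := Nat.le_ceil |u ((extChartAt (𝓡∂ n) c).symm z)|
  have h2 : (⌈|u ((extChartAt (𝓡∂ n) c).symm z)|⌉₊ : ℝ) ≤ j := by exact_mod_cast hj
  rw [cutField, if_pos (by linarith)]

theorem MemTau.memLp_cutField (hu : MemTau g p u) (hV : IsGenGradient g u V) {k : ℝ} (hk : 0 < k) :
    MemLp (fieldNorm g (cutField u k V)) (ENNReal.ofReal p) (riemVolume g) := by
  obtain ⟨W, hW, hWp⟩ := hu.trunc_grad k hk
  refine (memLp_congr_ae ?_).1 hWp
  filter_upwards [hW.ae_eq (hV k hk)] with x hx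
  exact fieldNorm_congr g hx

theorem MemTau.aemeasurable_trunc (hu : MemTau g p u) (k : ℝ) :
    AEMeasurable (fun x => trunc k (u x)) (riemVolume g) :=
  (continuous_trunc k).measurable.comp_aemeasurable hu.aemeasurable

theorem MemTau.memLp_trunc (hu : MemTau g p u) {k : ℝ} (hk : 0 ≤ k) (q : ℝ≥0∞) :
    MemLp (fun x => trunc k (u x)) q (riemVolume g) :=
  MemLp.of_bound (hu.aemeasurable_trunc k).aestronglyMeasurable k
    (ae_of_all _ fun x => abs_trunc_le hk (u x))

/-- The truncations of `u ∈ τ_0^{1,p}` belong to `W_0^{1,p}`: composing the approximating test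
functions with a smooth truncation makes them converge in `L^p`. -/
theorem MemTau0.memW0_trunc (hp : 1 ≤ p) (hu : MemTau0 g p u) (hV : IsGenGradient g u V) {k : ℝ}
    (hk : 0 < k) : MemW0 g p (fun x => trunc k (u x)) (cutField u k V) := by
  refine ⟨hu.memLp_trunc hk.le _, hV k hk, hu.memLp_cutField hV hk, ?_⟩
  obtain ⟨W, hW, θ, hθ, hloc, hgrad⟩ := hu.approx k hk
  have hWae := hW.ae_eq (hV k hk)
  have hgrad' : Tendsto (fun m => eLpNorm (fieldNorm g (grad g (θ m) - cutField u k V))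
      (ENNReal.ofReal p) (riemVolume g)) atTop (𝓝 0) := by
    refine hgrad.congr fun m => eLpNorm_congr_ae ?_
    filter_upwards [hWae] with x hx
    exact fieldNorm_congr g (by rw [Pi.sub_apply, Pi.sub_apply, hx])
  obtain ⟨S, hS, ⟨B, hB⟩, hS1, hSid, hSd, -, -⟩ := exists_smooth_trunc hk
  obtain ⟨φ, hφ, hφ1, hφ2⟩ := exists_test_approx_comp g hp hθ
    (tendstoInMeasure_of_tendsto_L1_loc g (fun m => (hθ m).measurable) (hu.aemeasurable_trunc k) hloc)
    (hV.chartMeasurable_cutField hk) (hu.memLp_cutField hV hk) hgrad' hS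
    (hSid 0 (by simpa using hk.le)) hB hS1
  refine ⟨φ, hφ, ?_, ?_⟩
  · have : (fun x => S (trunc k (u x))) = fun x => trunc k (u x) :=
      funext fun x => hSid _ (abs_trunc_le hk.le _)
    rwa [this] at hφ1
  · have : (fun x => deriv S (trunc k (u x)) • cutField u k V x) = cutField u k V :=
      funext fun x => by rw [hSd _ (abs_trunc_le hk.le _), one_smul]
    rwa [this] at hφ2

end Truncations

/-! ### Monotonicity of the `p`-Laplacian: scalar inequalities -/

section Scalar

variable {p a b q : ℝ}

/-- At `a = 0` both sides vanish, whatever the conventional value of `0 ^ (p - 2)` is. -/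
theorem rpow_sub_two_mul_sq (hp : 1 < p) (ha : 0 ≤ a) : a ^ (p - 2) * a ^ 2 = a ^ p := by
  rcases ha.eq_or_lt with rfl | ha
  · rw [Real.zero_rpow (show p ≠ 0 by linarith)]; simp
  · rw [← Real.rpow_natCast, ← Real.rpow_add ha]; norm_num

theorem rpow_sub_two_mul_self (hp : 1 < p) (ha : 0 ≤ a) : a ^ (p - 2) * a = a ^ (p - 1) := by
  rcases ha.eq_or_lt with rfl | ha
  · rw [Real.zero_rpow (show p - 1 ≠ 0 by linarith), mul_zero]
  · nth_rw 2 [← Real.rpow_one a]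
    rw [← Real.rpow_add ha]; congr 1; ring

theorem rpow_sub_one_mul_self (hp : 1 < p) (ha : 0 ≤ a) : a ^ (p - 1) * a = a ^ p := by
  rw [← rpow_sub_two_mul_self hp ha, mul_assoc, ← sq, rpow_sub_two_mul_sq hp ha]

/-- A form of Young's inequality with simple constants. -/
theorem rpow_sub_two_mul_abs_le (hp : 1 < p) (ha : 0 ≤ a) (hb : 0 ≤ b) (hq : |q| ≤ a * b) :
    a ^ (p - 2) * |q| ≤ a ^ p + b ^ p := by
  have h1 : a ^ (p - 2) * |q| ≤ a ^ (p - 1) * b := by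
    rw [← rpow_sub_two_mul_self hp ha, mul_assoc]
    exact mul_le_mul_of_nonneg_left hq (Real.rpow_nonneg ha _)
  refine h1.trans ?_
  have hap := Real.rpow_nonneg ha p
  have hbp := Real.rpow_nonneg hb p
  rcases le_total a b with h | h
  · have := mul_le_mul_of_nonneg_right (Real.rpow_le_rpow ha h (by linarith : 0 ≤ p - 1)) hb
    rw [rpow_sub_one_mul_self hp hb] at this
    linarith
  · have := mul_le_mul_of_nonneg_left h (Real.rpow_nonneg ha (p - 1))
    rw [rpow_sub_one_mul_self hp ha] at this
    linarith

/-- The quantity `⟨|v|^{p-2}v - |w|^{p-2}w, v - w⟩`, in terms of `a = |v|`, `b = |w|` and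
`q = ⟨v, w⟩`. -/
noncomputable def monotonicityGap (p a b q : ℝ) : ℝ :=
  a ^ (p - 2) * (a ^ 2 - q) + b ^ (p - 2) * (b ^ 2 - q)

theorem monotonicityGap_eq (hp : 1 < p) (ha : 0 ≤ a) (hb : 0 ≤ b) :
    monotonicityGap p a b q = (a ^ (p - 1) - b ^ (p - 1)) * (a - b) +
      (a ^ (p - 2) + b ^ (p - 2)) * (a * b - q) := by
  rw [monotonicityGap, ← rpow_sub_two_mul_self hp ha, ← rpow_sub_two_mul_self hp hb]
  ring

theorem sub_rpow_mul_sub_nonneg (hp : 1 < p) (ha : 0 ≤ a) (hb : 0 ≤ b) :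
    0 ≤ (a ^ (p - 1) - b ^ (p - 1)) * (a - b) := by
  rcases le_total a b with h | h
  · have := Real.rpow_le_rpow ha h (by linarith : 0 ≤ p - 1)
    exact mul_nonneg_of_nonpos_of_nonpos (by linarith) (by linarith)
  · have := Real.rpow_le_rpow hb h (by linarith : 0 ≤ p - 1)
    exact mul_nonneg (by linarith) (by linarith)

theorem monotonicityGap_nonneg (hp : 1 < p) (ha : 0 ≤ a) (hb : 0 ≤ b) (hq : |q| ≤ a * b) :
    0 ≤ monotonicityGap p a b q := by
  rw [monotonicityGap_eq hp ha hb]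
  refine add_nonneg (sub_rpow_mul_sub_nonneg hp ha hb) (mul_nonneg ?_ ?_)
  · exact add_nonneg (Real.rpow_nonneg ha _) (Real.rpow_nonneg hb _)
  · linarith [le_abs_self q]

theorem eq_of_monotonicityGap_eq_zero (hp : 1 < p) (ha : 0 ≤ a) (hb : 0 ≤ b) (hq : |q| ≤ a * b)
    (h : monotonicityGap p a b q = 0) : a ^ 2 - 2 * q + b ^ 2 = 0 := by
  rw [monotonicityGap_eq hp ha hb] at h
  have h1 := sub_rpow_mul_sub_nonneg hp ha hb
  have hq' : 0 ≤ a * b - q := by linarith [le_abs_self q]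
  have h2 : 0 ≤ (a ^ (p - 2) + b ^ (p - 2)) * (a * b - q) :=
    mul_nonneg (add_nonneg (Real.rpow_nonneg ha _) (Real.rpow_nonneg hb _)) hq'
  have hab : a = b := by
    rcases mul_eq_zero.1 (show (a ^ (p - 1) - b ^ (p - 1)) * (a - b) = 0 by linarith) with h | h
    · exact (Real.rpow_left_inj ha hb (show p - 1 ≠ 0 by linarith)).1 (by linarith)
    · linarith
  subst hab
  rcases ha.eq_or_lt with rfl | ha
  · have : q = 0 := by simpa using hq
    simp [this]
  · have hpos := Real.rpow_pos_of_pos ha (p - 2)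
    rcases mul_eq_zero.1 (show (a ^ (p - 2) + a ^ (p - 2)) * (a * a - q) = 0 by linarith) with h | h
    · linarith
    · linarith

/-- The pointwise inequality behind uniqueness: the monotonicity gap, on the set where neither
solution is truncated, is bounded by the two integrands of the entropy formulations up to energies
on the strips `{h ≤ |u| < h + k}` and `{h - k ≤ |u| < h}`. -/
theorem monotonicityGap_le (hp : 1 < p) (ha : 0 ≤ a) (hb : 0 ≤ b) (hq : |q| ≤ a * b)
    {s t h k : ℝ} :
    (if |s - t| < k ∧ |s| < h ∧ |t| < h then monotonicityGap p a b q else 0) ≤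
      (if |s - trunc h t| < k then a ^ (p - 2) * (a ^ 2 - if |t| < h then q else 0) else 0) +
      (if |t - trunc h s| < k then b ^ (p - 2) * (b ^ 2 - if |s| < h then q else 0) else 0) +
      ((if h ≤ |s| ∧ |s| < h + k then a ^ p else 0) +
        (if h ≤ |t| ∧ |t| < h + k then b ^ p else 0) +
        (if h - k ≤ |s| ∧ |s| < h then a ^ p else 0) +
        (if h - k ≤ |t| ∧ |t| < h then b ^ p else 0)) := by
  have hap := Real.rpow_nonneg ha p
  have hbp := Real.rpow_nonneg hb p
  have hA : 0 ≤ a ^ (p - 2) * a ^ 2 := by positivity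
  have hB : 0 ≤ b ^ (p - 2) * b ^ 2 := by positivity
  have hY1 := rpow_sub_two_mul_abs_le hp ha hb hq
  have hY2 := rpow_sub_two_mul_abs_le hp hb ha (by rwa [mul_comm] at hq)
  have hq1 : a ^ (p - 2) * q ≤ a ^ (p - 2) * |q| :=
    mul_le_mul_of_nonneg_left (le_abs_self q) (Real.rpow_nonneg ha _)
  have hq2 : b ^ (p - 2) * q ≤ b ^ (p - 2) * |q| :=
    mul_le_mul_of_nonneg_left (le_abs_self q) (Real.rpow_nonneg hb _)
  have hpos : ∀ (P : Prop) [Decidable P] (x : ℝ), 0 ≤ x → 0 ≤ (if P then x else 0) := by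
    intro P _ x hx
    split_ifs
    · exact hx
    · exact le_rfl
  have e1 := hpos (h ≤ |s| ∧ |s| < h + k) _ hap
  have e2 := hpos (h ≤ |t| ∧ |t| < h + k) _ hbp
  have e3 := hpos (h - k ≤ |s| ∧ |s| < h) _ hap
  have e4 := hpos (h - k ≤ |t| ∧ |t| < h) _ hbp
  by_cases hs : |s| < h
  · by_cases ht : |t| < h
    · rw [trunc_of_abs_le hs.le, trunc_of_abs_le ht.le]
      by_cases hst : |s - t| < k
      · have hts : |t - s| < k := by rwa [abs_sub_comm]
        simp only [hs, ht, hst, hts, and_self, if_true] at *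
        unfold monotonicityGap
        linarith
      · have hts : ¬ |t - s| < k := by rwa [abs_sub_comm]
        simp only [hst, hts, false_and, if_false] at *
        linarith
    · rw [if_neg (fun H => ht H.2.2), trunc_of_abs_le hs.le, if_neg ht, if_pos hs, sub_zero]
      have h1 := hpos (|s - trunc h t| < k) _ hA
      by_cases hts : |t - s| < k
      · have h2 := abs_sub_abs_le_abs_sub t s
        have h3 : h ≤ |t| ∧ |t| < h + k := ⟨not_lt.1 ht, by linarith⟩
        have h4 : h - k ≤ |s| ∧ |s| < h := ⟨by linarith, hs⟩
        rw [if_pos hts, if_pos h3, if_pos h4]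
        linarith
      · rw [if_neg hts]
        linarith
  · by_cases ht : |t| < h
    · rw [if_neg (fun H => hs H.2.1), trunc_of_abs_le ht.le, if_neg hs, if_pos ht, sub_zero]
      have h1 := hpos (|t - trunc h s| < k) _ hB
      by_cases hst : |s - t| < k
      · have h2 := abs_sub_abs_le_abs_sub s t
        have h3 : h ≤ |s| ∧ |s| < h + k := ⟨not_lt.1 hs, by linarith⟩
        have h4 : h - k ≤ |t| ∧ |t| < h := ⟨by linarith, ht⟩
        rw [if_pos hst, if_pos h3, if_pos h4]
        linarith
      · rw [if_neg hst]
        linarith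
    · rw [if_neg (fun H => hs H.2.1), if_neg hs, if_neg ht, sub_zero, sub_zero]
      have h1 := hpos (|s - trunc h t| < k) _ hA
      have h2 := hpos (|t - trunc h s| < k) _ hB
      linarith

end Scalar

/-! ### Energy estimates and equality of the gradients -/

section Measurability

variable {α : Type*} [MeasurableSpace α] {μ : Measure α}

theorem AEMeasurable.ite_zero {P : α → Prop} [DecidablePred P] (hP : NullMeasurableSet {x | P x} μ)
    {F : α → ℝ} (hF : AEMeasurable F μ) : AEMeasurable (fun x => if P x then F x else 0) μ := by
  refine (hF.indicator₀ hP).congr (ae_of_all _ fun x => ?_)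
  dsimp only
  by_cases hx : P x
  · rw [if_pos hx, indicator_of_mem (show x ∈ {x | P x} from hx)]
  · rw [if_neg hx, indicator_of_notMem (show x ∉ {x | P x} from hx)]

/-- Dominated convergence for `∫ T_k(w_h) f` when `w_h` is eventually constant at every point. -/
theorem tendsto_integral_trunc_mul {f : α → ℝ} (hf : Integrable f μ) {k : ℝ} (hk : 0 ≤ k)
    {w : ℝ → α → ℝ} {w' : α → ℝ} (hw : ∀ h, AEMeasurable (w h) μ)
    (hlim : ∀ x, ∀ᶠ h in atTop, w h x = w' x) :
    Tendsto (fun h => ∫ x, trunc k (w h x) * f x ∂μ) atTop (𝓝 (∫ x, trunc k (w' x) * f x ∂μ)) := by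
  refine tendsto_integral_filter_of_dominated_convergence (fun x => k * ‖f x‖)
    (Eventually.of_forall fun h => ?_) (Eventually.of_forall fun h => ae_of_all _ fun x => ?_)
    (hf.norm.const_mul k) (ae_of_all _ fun x => ?_)
  · exact (((continuous_trunc k).measurable.comp_aemeasurable (hw h)).mul
      hf.aestronglyMeasurable.aemeasurable).aestronglyMeasurable
  · rw [norm_mul]
    exact mul_le_mul_of_nonneg_right (abs_trunc_le hk _) (norm_nonneg _)
  · refine tendsto_const_nhds.congr' ?_
    filter_upwards [hlim x] with h hh
    rw [hh]

end Measurability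

section Entropy

variable {n : ℕ} [NeZero n] {M : Type*} [TopologicalSpace M]
  [ChartedSpace (EuclideanHalfSpace n) M] [IsManifold (𝓡∂ n) ∞ M]

/-- The energy density `|∇u|^p` on the strip `{h ≤ |u| < h + k}`. -/
noncomputable def stripEnergy (g : SmoothMetric n M) (p : ℝ) (u : M → ℝ) (V : VField n M)
    (h k : ℝ) (x : M) : ℝ :=
  if h ≤ |u x| ∧ |u x| < h + k then fieldNorm g V x ^ p else 0

/-- The integrand of the entropy formulation for `u`, with gradient `V`, tested with `T_h(t)`, where
`t` has gradient `W`. -/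
noncomputable def entropyIntegrand (g : SmoothMetric n M) (p : ℝ) (u : M → ℝ) (V : VField n M)
    (t : M → ℝ) (W : VField n M) (h k : ℝ) (x : M) : ℝ :=
  if |u x - trunc h (t x)| < k then
    fieldNorm g V x ^ (p - 2) *
      (fieldNorm g V x ^ 2 - if |t x| < h then g.inner x (V x) (W x) else 0) else 0

variable [T2Space M] [CompactSpace M] [MeasurableSpace M] [BorelSpace M]
  {g : SmoothMetric n M} {p : ℝ} {u t : M → ℝ} {V W : VField n M}

theorem fieldNorm_cutField_rpow (hp : 1 < p) (k : ℝ) (x : M) :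
    fieldNorm g (cutField u k V) x ^ p = if |u x| < k then fieldNorm g V x ^ p else 0 := by
  split_ifs with h
  · rw [fieldNorm_congr g (V := cutField u k V) (W := V) (if_pos h)]
  · rw [fieldNorm_eq_zero g |>.2 (if_neg h), Real.zero_rpow (show p ≠ 0 by linarith)]

theorem MemTau.integrable_energy (hp : 1 < p) (hu : MemTau g p u) (hV : IsGenGradient g u V)
    {k : ℝ} (hk : 0 < k) :
    Integrable (fun x => if |u x| < k then fieldNorm g V x ^ p else 0) (riemVolume g) := by
  have h := (hu.memLp_cutField hV hk).integrable_norm_rpow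
    (by simpa using (by linarith : 0 < p)) ENNReal.ofReal_ne_top
  rw [ENNReal.toReal_ofReal (by linarith)] at h
  refine h.congr (ae_of_all _ fun x => ?_)
  dsimp only
  rw [Real.norm_of_nonneg (fieldNorm_nonneg _ _ _), fieldNorm_cutField_rpow hp]

theorem MemTau.nullMeasurableSet_abs_lt (hu : MemTau g p u) (k : ℝ) :
    NullMeasurableSet {x | |u x| < k} (riemVolume g) :=
  nullMeasurableSet_lt hu.aemeasurable.abs aemeasurable_const

theorem MemTau.nullMeasurableSet_le_abs (hu : MemTau g p u) (k : ℝ) :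
    NullMeasurableSet {x | k ≤ |u x|} (riemVolume g) :=
  nullMeasurableSet_le aemeasurable_const hu.aemeasurable.abs

theorem MemTau.integrable_stripEnergy (hp : 1 < p) (hu : MemTau g p u) (hV : IsGenGradient g u V)
    {h k : ℝ} (hhk : 0 < h + k) : Integrable (stripEnergy g p u V h k) (riemVolume g) := by
  refine (hu.integrable_energy hp hV hhk).mono' ?_ (ae_of_all _ fun x => ?_)
  · exact (AEMeasurable.ite_zero (P := fun x => h ≤ |u x| ∧ |u x| < h + k)
      ((hu.nullMeasurableSet_le_abs h).inter (hu.nullMeasurableSet_abs_lt _))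
      (hV.chartMeasurable.aemeasurable_fieldNorm.pow_const p)).aestronglyMeasurable
  · have h0 := Real.rpow_nonneg (fieldNorm_nonneg g V x) p
    rw [stripEnergy]
    by_cases h1 : h ≤ |u x| ∧ |u x| < h + k
    · rw [if_pos h1, if_pos h1.2, Real.norm_of_nonneg h0]
    · rw [if_neg h1, norm_zero]
      split_ifs
      · exact h0
      · exact le_rfl

theorem stripEnergy_nonneg (h k : ℝ) (x : M) : 0 ≤ stripEnergy g p u V h k x := by
  rw [stripEnergy]
  split_ifs
  · exact Real.rpow_nonneg (fieldNorm_nonneg g V x) p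
  · exact le_rfl

theorem abs_lt_of_abs_sub_trunc_lt {s r h k : ℝ} (hh : 0 ≤ h) (hs : |s - trunc h r| < k) :
    |s| < h + k := by
  have h1 := abs_trunc_le hh r
  have h2 := abs_sub_abs_le_abs_sub s (trunc h r)
  linarith

theorem integrable_entropyIntegrand (hp : 1 < p) (hu : MemTau g p u) (hV : IsGenGradient g u V)
    (ht : MemTau g p t) (hW : IsGenGradient g t W) {h k : ℝ} (hh : 0 < h) (hk : 0 < k) :
    Integrable (entropyIntegrand g p u V t W h k) (riemVolume g) := by
  have hVm := hV.chartMeasurable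
  have hWm := hW.chartMeasurable
  refine (((hu.integrable_energy hp hV (add_pos hh hk)).const_mul 2).add
    (ht.integrable_energy hp hW hh)).mono' ?_ (ae_of_all _ fun x => ?_)
  · refine (AEMeasurable.ite_zero (nullMeasurableSet_lt
      (hu.aemeasurable.sub (ht.aemeasurable_trunc h)).abs aemeasurable_const)
      ((hVm.aemeasurable_fieldNorm.pow_const _).mul ((hVm.aemeasurable_fieldNorm.pow_const 2).sub
        (AEMeasurable.ite_zero (ht.nullMeasurableSet_abs_lt h)
          (hVm.aemeasurable_inner hWm))))).aestronglyMeasurable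
  · have ha := fieldNorm_nonneg g V x
    have hb := fieldNorm_nonneg g W x
    have hap := Real.rpow_nonneg ha p
    have hbp := Real.rpow_nonneg hb p
    have hY := rpow_sub_two_mul_abs_le hp ha hb (abs_inner_le g V W x)
    have hS := rpow_sub_two_mul_sq hp ha
    simp only [Pi.add_apply]
    rw [entropyIntegrand, Real.norm_eq_abs]
    by_cases h1 : |u x - trunc h (t x)| < k
    · rw [if_pos h1, if_pos (abs_lt_of_abs_sub_trunc_lt hh.le h1)]
      by_cases h2 : |t x| < h
      · rw [if_pos h2, if_pos h2, mul_sub]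
        refine (abs_sub _ _).trans ?_
        rw [abs_mul, abs_mul, abs_of_nonneg (Real.rpow_nonneg ha _), abs_of_nonneg (sq_nonneg _)]
        linarith
      · rw [if_neg h2, if_neg h2, sub_zero, hS, abs_of_nonneg hap]
        linarith
    · rw [if_neg h1, abs_zero]
      refine add_nonneg (mul_nonneg zero_le_two ?_) ?_
      · split_ifs
        · exact hap
        · exact le_rfl
      · split_ifs
        · exact hbp
        · exact le_rfl

/-- The entropy formulation for `u`, with `V` as its gradient. -/
def EntropyFormulation (g : SmoothMetric n M) (p : ℝ) (f u : M → ℝ) (V : VField n M) : Prop :=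
  ∀ (φ : M → ℝ) (Φ : VField n M), MemW0 g p φ Φ → MemLp φ ⊤ (riemVolume g) →
    ∀ k : ℝ, 0 < k →
      ∫ x in {x | |u x - φ x| < k},
          fieldNorm g V x ^ (p - 2) * g.inner x (V x) (V x - Φ x) ∂(riemVolume g) =
        ∫ x, trunc k (u x - φ x) * f x ∂(riemVolume g)

variable {f : M → ℝ}

/-- The entropy formulation tested with a truncation of another element of `τ_0^{1,p}`. -/
theorem EntropyFormulation.integral_entropyIntegrand (hp : 1 < p) (H : EntropyFormulation g p f u V)
    (hu : MemTau g p u) (ht : MemTau0 g p t) (hW : IsGenGradient g t W) {h k : ℝ} (hh : 0 < h)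
    (hk : 0 < k) :
    ∫ x, entropyIntegrand g p u V t W h k x ∂(riemVolume g) =
      ∫ x, trunc k (u x - trunc h (t x)) * f x ∂(riemVolume g) := by
  have hS : NullMeasurableSet {x | |u x - trunc h (t x)| < k} (riemVolume g) :=
    nullMeasurableSet_lt (hu.aemeasurable.sub (ht.aemeasurable_trunc h)).abs aemeasurable_const
  rw [← H _ _ (ht.memW0_trunc hp.le hW hh) (ht.memLp_trunc hh.le ⊤) k hk,
    ← integral_indicator₀ hS]
  refine integral_congr_ae (ae_of_all _ fun x => ?_)
  dsimp only [entropyIntegrand]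
  by_cases h1 : |u x - trunc h (t x)| < k
  · rw [if_pos h1, indicator_of_mem (show x ∈ {x | |u x - trunc h (t x)| < k} from h1),
      fieldNorm_sq, map_sub]
    congr 2
    by_cases h2 : |t x| < h
    · rw [if_pos h2, cutField, if_pos h2]
    · rw [if_neg h2, cutField, if_neg h2, map_zero]
  · rw [if_neg h1, indicator_of_notMem (show x ∉ {x | |u x - trunc h (t x)| < k} from h1)]

/-- Testing with `T_h(u)` itself gives the energy of `u` on a strip. -/
theorem EntropyFormulation.integral_stripEnergy (hp : 1 < p) (H : EntropyFormulation g p f u V)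
    (hu : MemTau0 g p u) (hV : IsGenGradient g u V) {h k : ℝ} (hh : 0 < h) (hk : 0 < k) :
    ∫ x, stripEnergy g p u V h k x ∂(riemVolume g) =
      ∫ x, trunc k (u x - trunc h (u x)) * f x ∂(riemVolume g) := by
  rw [← H.integral_entropyIntegrand hp hu.toMemTau hu hV hh hk]
  refine integral_congr_ae (ae_of_all _ fun x => ?_)
  simp only [stripEnergy, entropyIntegrand]
  by_cases h1 : |u x| < h
  · rw [if_neg (fun H => absurd h1 (not_lt.2 H.1)), if_pos h1, fieldNorm_sq, sub_self, mul_zero]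
    simp
  · have h1' := not_lt.1 h1
    have h2 : |u x - trunc h (u x)| = |u x| - h := by
      rcases le_abs.1 h1' with h3 | h3
      · rw [trunc_of_le hh.le h3, abs_of_nonneg (by linarith), abs_of_nonneg (by linarith)]
      · rw [trunc_of_le_neg (by linarith), abs_of_nonpos (by linarith), abs_of_nonpos (by linarith)]
        ring
    rw [h2, if_neg h1, sub_zero, rpow_sub_two_mul_sq hp (fieldNorm_nonneg g V x)]
    by_cases h3 : |u x| < h + k
    · rw [if_pos ⟨h1', h3⟩, if_pos (by linarith)]
    · rw [if_neg (fun H => h3 H.2), if_neg (by linarith)]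

theorem eventually_trunc_eq (s : ℝ) : ∀ᶠ h in atTop, trunc h s = s := by
  filter_upwards [eventually_ge_atTop |s|] with h hh
  exact trunc_of_abs_le hh

theorem EntropyFormulation.tendsto_integral_stripEnergy (hp : 1 < p)
    (H : EntropyFormulation g p f u V) (hf : Integrable f (riemVolume g))
    (hu : MemTau0 g p u) (hV : IsGenGradient g u V) {k : ℝ} (hk : 0 < k) :
    Tendsto (fun h => ∫ x, stripEnergy g p u V h k x ∂(riemVolume g)) atTop (𝓝 0) := by
  have h1 := tendsto_integral_trunc_mul hf hk.le (w := fun h x => u x - trunc h (u x))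
    (w' := fun _ => 0) (fun h => hu.aemeasurable.sub (hu.aemeasurable_trunc h)) fun x => by
      filter_upwards [eventually_trunc_eq (u x)] with h hh
      rw [hh, sub_self]
  have h0 : trunc k 0 = 0 := trunc_of_abs_le (by simpa using hk.le)
  simp only [h0, zero_mul, integral_zero] at h1
  refine h1.congr' ?_
  filter_upwards [eventually_gt_atTop 0] with h hh
  exact (H.integral_stripEnergy hp hu hV hh hk).symm

/-- Two entropy solutions have the same gradient almost everywhere. -/
theorem EntropyFormulation.ae_gradient_eq (hp : 1 < p) (H₁ : EntropyFormulation g p f u V)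
    (H₂ : EntropyFormulation g p f t W) (hf : Integrable f (riemVolume g))
    (hu : MemTau0 g p u) (hV : IsGenGradient g u V) (ht : MemTau0 g p t)
    (hW : IsGenGradient g t W) : ∀ᵐ x ∂(riemVolume g), V x = W x := by
  have hVm := hV.chartMeasurable
  have hWm := hW.chartMeasurable
  let D : M → ℝ := fun x =>
    monotonicityGap p (fieldNorm g V x) (fieldNorm g W x) (g.inner x (V x) (W x))
  have hDm : AEMeasurable D (riemVolume g) :=
    ((hVm.aemeasurable_fieldNorm.pow_const _).mul
      ((hVm.aemeasurable_fieldNorm.pow_const 2).sub (hVm.aemeasurable_inner hWm))).add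
    ((hWm.aemeasurable_fieldNorm.pow_const _).mul
      ((hWm.aemeasurable_fieldNorm.pow_const 2).sub (hVm.aemeasurable_inner hWm)))
  have hD0 : ∀ x, 0 ≤ D x := fun x => monotonicityGap_nonneg hp (fieldNorm_nonneg g V x)
    (fieldNorm_nonneg g W x) (abs_inner_le g V W x)
  let G : ℝ → ℝ → M → ℝ := fun k h x =>
    if |u x - t x| < k ∧ |u x| < h ∧ |t x| < h then D x else 0
  let R : ℝ → ℝ → M → ℝ := fun k h x =>
    entropyIntegrand g p u V t W h k x + entropyIntegrand g p t W u V h k x +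
      (stripEnergy g p u V h k x + stripEnergy g p t W h k x +
        stripEnergy g p u V (h - k) k x + stripEnergy g p t W (h - k) k x)
  have hG0 : ∀ k h x, 0 ≤ G k h x := by
    intro k h x
    dsimp only [G]
    split_ifs
    · exact hD0 x
    · exact le_rfl
  have hGR : ∀ k h x, G k h x ≤ R k h x := by
    intro k h x
    have := monotonicityGap_le hp (fieldNorm_nonneg g V x) (fieldNorm_nonneg g W x)
      (abs_inner_le g V W x) (s := u x) (t := t x) (h := h) (k := k)
    simp only [G, R, D, stripEnergy, entropyIntegrand, sub_add_cancel, g.symm x (W x) (V x)]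
    exact this
  have hRint : ∀ k > 0, ∀ h > 0, Integrable (R k h) (riemVolume g) := by
    intro k hk h hh
    exact ((integrable_entropyIntegrand hp hu.toMemTau hV ht.toMemTau hW hh hk).add
      (integrable_entropyIntegrand hp ht.toMemTau hW hu.toMemTau hV hh hk)).add
      ((((hu.integrable_stripEnergy hp hV (add_pos hh hk)).add
        (ht.integrable_stripEnergy hp hW (add_pos hh hk))).add
        (hu.integrable_stripEnergy hp hV (by linarith))).add
        (ht.integrable_stripEnergy hp hW (by linarith)))
  have hGint : ∀ k > 0, ∀ h > 0, Integrable (G k h) (riemVolume g) := by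
    intro k hk h hh
    refine (hRint k hk h hh).mono' ?_ (ae_of_all _ fun x => ?_)
    · exact (AEMeasurable.ite_zero
        (P := fun x => |u x - t x| < k ∧ |u x| < h ∧ |t x| < h) ((nullMeasurableSet_lt
        (hu.aemeasurable.sub ht.aemeasurable).abs aemeasurable_const).inter
        ((hu.nullMeasurableSet_abs_lt h).inter (ht.nullMeasurableSet_abs_lt h))) hDm).aestronglyMeasurable
    · rw [Real.norm_of_nonneg (hG0 k h x)]
      exact hGR k h x
  have hRlim : ∀ k > 0, Tendsto (fun h => ∫ x, R k h x ∂(riemVolume g)) atTop (𝓝 0) := by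
    intro k hk
    have l1 := tendsto_integral_trunc_mul hf hk.le (w := fun h x => u x - trunc h (t x))
      (w' := fun x => u x - t x) (fun h => hu.aemeasurable.sub (ht.aemeasurable_trunc h))
      fun x => by filter_upwards [eventually_trunc_eq (t x)] with h hh; rw [hh]
    have l2 := tendsto_integral_trunc_mul hf hk.le (w := fun h x => t x - trunc h (u x))
      (w' := fun x => t x - u x) (fun h => ht.aemeasurable.sub (hu.aemeasurable_trunc h))
      fun x => by filter_upwards [eventually_trunc_eq (u x)] with h hh; rw [hh]
    -- the two limits cancel, as `T_k` is odd
    have hcancel : ∫ x, trunc k (t x - u x) * f x ∂(riemVolume g) =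
        -∫ x, trunc k (u x - t x) * f x ∂(riemVolume g) := by
      rw [← integral_neg]
      refine integral_congr_ae (ae_of_all _ fun x => ?_)
      dsimp only
      rw [← neg_sub (u x) (t x), trunc_neg _ _ hk.le, neg_mul]
    have s1 := H₁.tendsto_integral_stripEnergy hp hf hu hV hk
    have s2 := H₂.tendsto_integral_stripEnergy hp hf ht hW hk
    have hshift : Tendsto (fun h : ℝ => h - k) atTop atTop :=
      tendsto_atTop_add_const_right _ (-k) tendsto_id
    have hsum := (l1.add l2).add (((s1.add s2).add (s1.comp hshift)).add (s2.comp hshift))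
    rw [hcancel] at hsum
    simp only [add_neg_cancel, add_zero] at hsum
    refine hsum.congr' ?_
    filter_upwards [eventually_gt_atTop 0] with h hh
    have i1 := integrable_entropyIntegrand hp hu.toMemTau hV ht.toMemTau hW hh hk
    have i2 := integrable_entropyIntegrand hp ht.toMemTau hW hu.toMemTau hV hh hk
    have j1 := hu.integrable_stripEnergy hp hV (add_pos hh hk)
    have j2 := ht.integrable_stripEnergy hp hW (add_pos hh hk)
    have j3 := hu.integrable_stripEnergy hp hV (h := h - k) (k := k) (by linarith)
    have j4 := ht.integrable_stripEnergy hp hW (h := h - k) (k := k) (by linarith)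
    have hR : ∫ x, R k h x ∂(riemVolume g) = _ :=
      (integral_add (i1.add i2) (((j1.add j2).add j3).add j4)).trans
        (congrArg₂ (· + ·) (integral_add i1 i2)
          ((integral_add ((j1.add j2).add j3) j4).trans
            (congrArg₂ (· + ·) ((integral_add (j1.add j2) j3).trans
              (congrArg₂ (· + ·) (integral_add j1 j2) rfl)) rfl)))
    rw [hR, H₁.integral_entropyIntegrand hp hu.toMemTau ht hW hh hk,
      H₂.integral_entropyIntegrand hp ht.toMemTau hu hV hh hk]
    rfl
  -- `G k h` increases with `h`, hence its integral is bounded by the limit of `∫ R k h'`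
  have hGzero : ∀ k > 0, ∀ h > 0, G k h =ᵐ[riemVolume g] 0 := by
    intro k hk h hh
    refine (integral_eq_zero_iff_of_nonneg (hG0 k h) (hGint k hk h hh)).1 ?_
    refine le_antisymm ?_ (integral_nonneg (hG0 k h))
    refine ge_of_tendsto (hRlim k hk) ?_
    filter_upwards [eventually_ge_atTop h] with h' hh'
    refine integral_mono (hGint k hk h hh) (hRint k hk h' (hh.trans_le hh')) fun x => ?_
    refine le_trans ?_ (hGR k h' x)
    dsimp only [G]
    by_cases hx : |u x - t x| < k ∧ |u x| < h ∧ |t x| < h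
    · rw [if_pos hx, if_pos ⟨hx.1, hx.2.1.trans_le hh', hx.2.2.trans_le hh'⟩]
    · rw [if_neg hx]
      exact hG0 k h' x
  have hall : ∀ᵐ x ∂(riemVolume g), ∀ j : ℕ, G (2 * j + 1) (j + 1) x = 0 :=
    ae_all_iff.2 fun j => hGzero _ (by positivity) _ (by positivity)
  filter_upwards [hall] with x hx
  -- `j` bounds `|u x|` and `|t x|`, so that `x` lies in the set for `k = 2j + 1` and `h = j + 1`
  obtain ⟨j, hj⟩ := exists_nat_ge (max |u x| |t x|)
  have hju := (le_max_left _ _).trans hj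
  have hjt := (le_max_right _ _).trans hj
  have hDx : D x = 0 := by
    have h1 := hx j
    dsimp only [G] at h1
    rwa [if_pos ⟨by linarith [abs_sub (u x) (t x)], by linarith, by linarith⟩] at h1
  have h2 := eq_of_monotonicityGap_eq_zero hp (fieldNorm_nonneg g V x) (fieldNorm_nonneg g W x)
    (abs_inner_le g V W x) hDx
  rw [← fieldNorm_sub_sq] at h2
  exact sub_eq_zero.1 ((fieldNorm_eq_zero g).1 (pow_eq_zero_iff two_ne_zero |>.1 h2))

end Entropy

/-! ### Uniqueness -/

section Uniqueness

variable {n : ℕ} [NeZero n] {M : Type*} [TopologicalSpace M]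
  [ChartedSpace (EuclideanHalfSpace n) M] [IsManifold (𝓡∂ n) ∞ M]
  [T2Space M] [CompactSpace M] [MeasurableSpace M] [BorelSpace M]
  {g : SmoothMetric n M} {p : ℝ} {u t f : M → ℝ} {V W : VField n M}

theorem IsTestFunction.aestronglyMeasurable_fieldNorm_grad {θ : M → ℝ} (hθ : IsTestFunction n θ) :
    AEStronglyMeasurable (fieldNorm g (grad g θ)) (riemVolume g) :=
  (hθ.chartMeasurable_grad g).aemeasurable_fieldNorm.aestronglyMeasurable

/-- A smooth bounded function of the difference of two truncations is approximated by test
functions, with the expected gradient. -/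
theorem exists_test_approx_diff (hp : 1 < p) (hu : MemTau0 g p u) (hV : IsGenGradient g u V)
    (ht : MemTau0 g p t) (hW : IsGenGradient g t W) {S : ℝ → ℝ} (hS : ContDiff ℝ ∞ S)
    (hS0 : S 0 = 0) {B : ℝ} (hB : ∀ s, |S s| ≤ B) (hS1 : ∀ s, |deriv S s| ≤ 1) {h : ℝ} (hh : 0 < h)
    {ε : ℝ≥0∞} (hε : 0 < ε) : ∃ φ : M → ℝ, IsTestFunction n φ ∧
      eLpNorm (φ - fun x => S (trunc h (u x) - trunc h (t x))) (ENNReal.ofReal p)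
        (riemVolume g) ≤ ε ∧
      eLpNorm (fieldNorm g (grad g φ)) (ENNReal.ofReal p) (riemVolume g) ≤ ε +
        eLpNorm (fieldNorm g (fun x => deriv S (trunc h (u x) - trunc h (t x)) •
          (cutField u h V - cutField t h W) x)) (ENNReal.ofReal p) (riemVolume g) := by
  have hp1 : (1 : ℝ≥0∞) ≤ ENNReal.ofReal p := by simpa using hp.le
  have hp0 : ENNReal.ofReal p ≠ 0 := by simpa using (by linarith : 0 < p)
  obtain ⟨-, -, hVp, θ, hθ, hθ1, hθ2⟩ := hu.memW0_trunc hp.le hV hh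
  obtain ⟨-, -, hWp, η, hη, hη1, hη2⟩ := ht.memW0_trunc hp.le hW hh
  have hVm := hV.chartMeasurable_cutField hh
  have hWm := hW.chartMeasurable_cutField hh
  have hum := (hu.aemeasurable_trunc h).aestronglyMeasurable
  have htm := (ht.aemeasurable_trunc h).aestronglyMeasurable
  have hθm := fun m => (hθ m).measurable.aestronglyMeasurable (μ := riemVolume g)
  have hηm := fun m => (hη m).measurable.aestronglyMeasurable (μ := riemVolume g)
  have hmeas : TendstoInMeasure (riemVolume g) (fun m => θ m - η m) atTop
      (fun x => trunc h (u x) - trunc h (t x)) := by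
    refine tendstoInMeasure_of_tendsto_eLpNorm hp0 (fun m => (hθm m).sub (hηm m)) (hum.sub htm) ?_
    have hsum := hθ1.add hη1
    rw [add_zero] at hsum
    refine tendsto_of_tendsto_of_tendsto_of_le_of_le tendsto_const_nhds hsum (fun _ => zero_le)
      fun m => ?_
    have heq : (θ m - η m) - (fun x => trunc h (u x) - trunc h (t x)) =
        (θ m - fun x => trunc h (u x)) - (η m - fun x => trunc h (t x)) := by
      ext x
      simp only [Pi.sub_apply]
      ring
    change eLpNorm ((θ m - η m) - (fun x => trunc h (u x) - trunc h (t x))) _ _ ≤ _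
    rw [heq]
    exact eLpNorm_sub_le ((hθm m).sub hum) ((hηm m).sub htm) hp1
  have hgrad : Tendsto (fun m => eLpNorm (fieldNorm g (grad g (θ m - η m) -
      (cutField u h V - cutField t h W))) (ENNReal.ofReal p) (riemVolume g)) atTop (𝓝 0) := by
    have hsum := hθ2.add hη2
    rw [add_zero] at hsum
    refine tendsto_of_tendsto_of_tendsto_of_le_of_le tendsto_const_nhds hsum (fun _ => zero_le)
      fun m => ?_
    refine (eLpNorm_mono_real (g := fieldNorm g (grad g (θ m) - cutField u h V) +
      fieldNorm g (grad g (η m) - cutField t h W)) fun x => ?_).trans (eLpNorm_add_le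
        (((hθ m).chartMeasurable_grad g).sub hVm).aemeasurable_fieldNorm.aestronglyMeasurable
        (((hη m).chartMeasurable_grad g).sub hWm).aemeasurable_fieldNorm.aestronglyMeasurable hp1)
    rw [Real.norm_of_nonneg (fieldNorm_nonneg _ _ _), grad_sub g (hθ m) (hη m), sub_sub_sub_comm]
    exact fieldNorm_sub_le g _ _ x
  have hdiffp : MemLp (fieldNorm g (cutField u h V - cutField t h W)) (ENNReal.ofReal p)
      (riemVolume g) := by
    refine (hVp.add hWp).mono' (hVm.sub hWm).aemeasurable_fieldNorm.aestronglyMeasurable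
      (ae_of_all _ fun x => ?_)
    rw [Real.norm_of_nonneg (fieldNorm_nonneg _ _ _)]
    exact fieldNorm_sub_le g _ _ x
  obtain ⟨φ, hφ, hφ1, hφ2⟩ := exists_test_approx_comp g hp.le (fun m => (hθ m).sub (hη m)) hmeas
    (hVm.sub hWm) hdiffp hgrad hS hS0 hB hS1
  obtain ⟨m, hm1, hm2⟩ := ((ENNReal.tendsto_nhds_zero.1 hφ1 ε hε).and
    (ENNReal.tendsto_nhds_zero.1 hφ2 ε hε)).exists
  refine ⟨φ m, hφ m, hm1, ?_⟩
  set Y : VField n M := fun x => deriv S (trunc h (u x) - trunc h (t x)) •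
    (cutField u h V - cutField t h W) x with hY
  have hS'm : AEMeasurable (fun x => deriv S (trunc h (u x) - trunc h (t x))) (riemVolume g) :=
    (hS.continuous_deriv (by simp)).measurable.comp_aemeasurable
      ((hu.aemeasurable_trunc h).sub (ht.aemeasurable_trunc h))
  have hYm : AEMeasurable (fieldNorm g Y) (riemVolume g) := by
    refine (hS'm.abs.mul (hVm.sub hWm).aemeasurable_fieldNorm).congr (ae_of_all _ fun x => ?_)
    exact (fieldNorm_smul g (fun x => deriv S (trunc h (u x) - trunc h (t x)))
      (cutField u h V - cutField t h W) x).symm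
  have hYdm : AEMeasurable (fieldNorm g (grad g (φ m) - Y)) (riemVolume g) := by
    have hG := (hφ m).chartMeasurable_grad g
    have h1 : AEMeasurable (fun x => Real.sqrt (fieldNorm g (grad g (φ m)) x ^ 2 -
        2 * (deriv S (trunc h (u x) - trunc h (t x)) * g.inner x (grad g (φ m) x)
          ((cutField u h V - cutField t h W) x)) + fieldNorm g Y x ^ 2)) (riemVolume g) :=
      (((hG.aemeasurable_fieldNorm.pow_const 2).sub
        ((hS'm.mul (hG.aemeasurable_inner (hVm.sub hWm))).const_mul 2)).add (hYm.pow_const 2)).sqrt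
    refine h1.congr (ae_of_all _ fun x => ?_)
    have h2 := fieldNorm_sub_sq g (grad g (φ m)) Y x
    dsimp only
    rw [← Real.sqrt_sq (fieldNorm_nonneg g (grad g (φ m) - Y) x), h2]
    congr 3
    rw [hY, map_smul, smul_eq_mul]
  refine (eLpNorm_mono_real (g := fieldNorm g (grad g (φ m) - Y) + fieldNorm g Y)
    fun x => ?_).trans ((eLpNorm_add_le hYdm.aestronglyMeasurable hYm.aestronglyMeasurable
      hp1).trans (add_le_add hm2 le_rfl))
  rw [Real.norm_of_nonneg (fieldNorm_nonneg _ _ _)]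
  have := fieldNorm_add_le g (grad g (φ m) - Y) Y x
  rwa [sub_add_cancel] at this

/-- Where the gradients of `u` and `t` agree, the gradient of `S(T_h(u) - T_h(t))`, with `S` constant
on each side of `(-2, 2)`, is carried by the strips where only one of them is truncated. -/
theorem rpow_fieldNorm_diff_le (hp : 1 < p) {S : ℝ → ℝ} (hS1 : ∀ s, |deriv S s| ≤ 1)
    (hS2 : ∀ s, 2 ≤ |s| → deriv S s = 0) {h : ℝ} (hh : 0 < h) {x : M} (hVW : V x = W x) :
    fieldNorm g (fun x => deriv S (trunc h (u x) - trunc h (t x)) •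
        (cutField u h V - cutField t h W) x) x ^ p ≤
      stripEnergy g p u V (h - 2) 2 x + stripEnergy g p t W (h - 2) 2 x := by
  have hp0 : p ≠ 0 := by linarith
  have e1 := stripEnergy_nonneg (g := g) (p := p) (u := u) (V := V) (h - 2) 2 x
  have e2 := stripEnergy_nonneg (g := g) (p := p) (u := t) (V := W) (h - 2) 2 x
  have hzero : ∀ a : ℝ, a = 0 → a ^ p ≤
      stripEnergy g p u V (h - 2) 2 x + stripEnergy g p t W (h - 2) 2 x := by
    rintro _ rfl
    rw [Real.zero_rpow hp0]
    linarith
  rw [fieldNorm_smul g (fun x => deriv S (trunc h (u x) - trunc h (t x)))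
    (cutField u h V - cutField t h W) x]
  by_cases hv : 2 ≤ |trunc h (u x) - trunc h (t x)|
  · exact hzero _ (by rw [hS2 _ hv, abs_zero, zero_mul])
  have hv' := not_le.1 hv
  have habs : ∀ s, h ≤ |s| → |trunc h s| = h := by
    intro s hs
    rcases le_abs.1 hs with h3 | h3
    · rw [trunc_of_le hh.le h3, abs_of_pos hh]
    · rw [trunc_of_le_neg (by linarith), abs_neg, abs_of_pos hh]
  refine (Real.rpow_le_rpow (mul_nonneg (abs_nonneg _) (fieldNorm_nonneg g _ x))
    (mul_le_of_le_one_left (fieldNorm_nonneg g _ x) (hS1 _)) (by linarith)).trans ?_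
  by_cases h1 : |u x| < h
  · by_cases h2 : |t x| < h
    · refine hzero _ ((fieldNorm_eq_zero g).2 ?_)
      rw [Pi.sub_apply, cutField, cutField, if_pos h1, if_pos h2, hVW, sub_self]
    · have h3 : fieldNorm g (cutField u h V - cutField t h W) x = fieldNorm g V x :=
        fieldNorm_congr g (by rw [Pi.sub_apply, cutField, cutField, if_pos h1, if_neg h2, sub_zero])
      have h4 : h - 2 ≤ |u x| ∧ |u x| < h - 2 + 2 := by
        have h5 := habs _ (not_lt.1 h2)
        have h6 := abs_sub_abs_le_abs_sub (trunc h (t x)) (trunc h (u x))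
        rw [abs_sub_comm, h5, trunc_of_abs_le h1.le] at h6
        rw [trunc_of_abs_le h1.le] at hv'
        exact ⟨by linarith, by linarith⟩
      rw [h3]
      have h7 : stripEnergy g p u V (h - 2) 2 x = fieldNorm g V x ^ p := if_pos h4
      linarith
  · by_cases h2 : |t x| < h
    · have h3 : fieldNorm g (cutField u h V - cutField t h W) x = fieldNorm g W x := by
        rw [← fieldNorm_neg g W x]
        exact fieldNorm_congr g
          (by rw [Pi.sub_apply, cutField, cutField, if_neg h1, if_pos h2, zero_sub, Pi.neg_apply])
      have h4 : h - 2 ≤ |t x| ∧ |t x| < h - 2 + 2 := by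
        have h5 := habs _ (not_lt.1 h1)
        have h6 := abs_sub_abs_le_abs_sub (trunc h (u x)) (trunc h (t x))
        rw [h5, trunc_of_abs_le h2.le] at h6
        rw [trunc_of_abs_le h2.le] at hv'
        exact ⟨by linarith, by linarith⟩
      rw [h3]
      have h7 : stripEnergy g p t W (h - 2) 2 x = fieldNorm g W x ^ p := if_pos h4
      linarith
    · refine hzero _ ((fieldNorm_eq_zero g).2 ?_)
      rw [Pi.sub_apply, cutField, cutField, if_neg h1, if_neg h2, sub_self]

/-- The gradient of `S(T_h(u) - T_h(t))` tends to zero in `L^p` as `h → ∞`. -/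
theorem tendsto_eLpNorm_diff (hp : 1 < p) (H₁ : EntropyFormulation g p f u V)
    (H₂ : EntropyFormulation g p f t W) (hf : Integrable f (riemVolume g))
    (hu : MemTau0 g p u) (hV : IsGenGradient g u V) (ht : MemTau0 g p t)
    (hW : IsGenGradient g t W) {S : ℝ → ℝ} (hS1 : ∀ s, |deriv S s| ≤ 1)
    (hS2 : ∀ s, 2 ≤ |s| → deriv S s = 0) :
    Tendsto (fun h : ℝ => eLpNorm (fieldNorm g (fun x =>
      deriv S (trunc h (u x) - trunc h (t x)) • (cutField u h V - cutField t h W) x))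
        (ENNReal.ofReal p) (riemVolume g)) atTop (𝓝 0) := by
  have hp0 : 0 < p := by linarith
  have hshift : Tendsto (fun h : ℝ => h - 2) atTop atTop :=
    tendsto_atTop_add_const_right _ (-2) tendsto_id
  have hE := ((H₁.tendsto_integral_stripEnergy hp hf hu hV two_pos).comp hshift).add
    ((H₂.tendsto_integral_stripEnergy hp hf ht hW two_pos).comp hshift)
  have hE' := (ENNReal.tendsto_ofReal hE).ennrpow_const (1 / p)
  rw [add_zero, ENNReal.ofReal_zero, ENNReal.zero_rpow_of_pos (by positivity)] at hE'
  refine tendsto_of_tendsto_of_tendsto_of_le_of_le' tendsto_const_nhds hE'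
    (Eventually.of_forall fun _ => zero_le) ?_
  filter_upwards [eventually_gt_atTop 0] with h hh
  have i1 := hu.integrable_stripEnergy hp hV (h := h - 2) (k := 2) (by linarith)
  have i2 := ht.integrable_stripEnergy hp hW (h := h - 2) (k := 2) (by linarith)
  rw [eLpNorm_eq_lintegral_rpow_enorm_toReal (by simpa using hp0) ENNReal.ofReal_ne_top,
    ENNReal.toReal_ofReal hp0.le]
  refine ENNReal.rpow_le_rpow ?_ (by positivity)
  have i3 : Integrable (fun x => stripEnergy g p u V (h - 2) 2 x + stripEnergy g p t W (h - 2) 2 x)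
      (riemVolume g) := i1.add i2
  have hadd : ∫ x, (stripEnergy g p u V (h - 2) 2 x + stripEnergy g p t W (h - 2) 2 x)
      ∂(riemVolume g) = _ := integral_add i1 i2
  simp only [Function.comp_apply]
  rw [← hadd, ofReal_integral_eq_lintegral_ofReal i3
    (ae_of_all _ fun x => add_nonneg (stripEnergy_nonneg _ _ x) (stripEnergy_nonneg _ _ x))]
  refine lintegral_mono_ae ?_
  filter_upwards [H₁.ae_gradient_eq hp H₂ hf hu hV ht hW] with x hx
  rw [Real.enorm_of_nonneg (fieldNorm_nonneg _ _ _),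
    ENNReal.ofReal_rpow_of_nonneg (fieldNorm_nonneg _ _ _) hp0.le]
  exact ENNReal.ofReal_le_ofReal (rpow_fieldNorm_diff_le hp hS1 hS2 hh hx)

/-- Two entropy solutions coincide almost everywhere: the functions `S(T_h(u) - T_h(t))`, for smooth
bounded `S` vanishing only at `0`, are approximated by test functions to which the qualitative
Poincaré inequality applies. -/
theorem EntropyFormulation.ae_eq (hbd : ∀ x : M, ∃ y ∈ (𝓡∂ n).boundary M, y ∈ connectedComponent x)
    (hp : 1 < p) (H₁ : EntropyFormulation g p f u V)
    (H₂ : EntropyFormulation g p f t W) (hf : Integrable f (riemVolume g))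
    (hu : MemTau0 g p u) (hV : IsGenGradient g u V) (ht : MemTau0 g p t)
    (hW : IsGenGradient g t W) : u =ᵐ[riemVolume g] t := by
  have hp1 : (1 : ℝ≥0∞) ≤ ENNReal.ofReal p := by simpa using hp.le
  have hp0 : ENNReal.ofReal p ≠ 0 := by simpa using (by linarith : 0 < p)
  obtain ⟨S, hS, ⟨B, hB⟩, hS1, hSid, -, hS2, hS0⟩ := exists_smooth_trunc one_pos
  have hS2' : ∀ s, 2 ≤ |s| → deriv S s = 0 := fun s hs => hS2 s (by linarith)
  have hlim := tendsto_eLpNorm_diff hp H₁ H₂ hf hu hV ht hW hS1 hS2'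
  let ε : ℕ → ℝ≥0∞ := fun j => 2⁻¹ ^ j
  have hε : ∀ j, 0 < ε j := fun j => ENNReal.pow_pos (by simp) j
  have hεsum : ∑' j, ε j ≠ ⊤ := by
    simp only [ε, ENNReal.tsum_geometric, ENNReal.one_sub_inv_two, inv_inv]
    exact ENNReal.ofNat_ne_top
  have hch : ∀ j : ℕ, ∃ h : ℝ, (j : ℝ) ≤ h ∧ 0 < h ∧ eLpNorm (fieldNorm g (fun x =>
      deriv S (trunc h (u x) - trunc h (t x)) • (cutField u h V - cutField t h W) x))
        (ENNReal.ofReal p) (riemVolume g) ≤ ε j := fun j =>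
    ((eventually_ge_atTop (j : ℝ)).and ((eventually_gt_atTop 0).and
      (ENNReal.tendsto_nhds_zero.1 hlim (ε j) (hε j)))).exists
  choose h hj hpos hsmall using hch
  have hch2 := fun j => exists_test_approx_diff hp hu hV ht hW hS (hSid 0 (by simp)) hB hS1
    (hpos j) (hε j)
  choose φ hφ hφ1 hφ2 using hch2
  have hgradsum : ∑' j, ∫⁻ x, ENNReal.ofReal (fieldNorm g (grad g (φ j)) x) ∂(riemVolume g) ≠ ⊤ := by
    set C : ℝ≥0∞ := riemVolume g univ ^
      (1 / (1 : ℝ≥0∞).toReal - 1 / (ENNReal.ofReal p).toReal) with hC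
    have hCt : C ≠ ⊤ := by
      refine (ENNReal.rpow_lt_top_of_nonneg ?_ (measure_ne_top _ _)).ne
      rw [ENNReal.toReal_ofReal (by linarith), ENNReal.toReal_one, div_one, sub_nonneg]
      exact (div_le_one (by linarith)).2 hp.le
    have hle : ∀ j, ∫⁻ x, ENNReal.ofReal (fieldNorm g (grad g (φ j)) x) ∂(riemVolume g) ≤
        ε j * (2 * C) := by
      intro j
      have h1 := eLpNorm_le_eLpNorm_mul_rpow_measure_univ hp1
        ((hφ j).aestronglyMeasurable_fieldNorm_grad (g := g))
      rw [eLpNorm_one_eq_lintegral_enorm] at h1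
      simp only [Real.enorm_of_nonneg (fieldNorm_nonneg _ _ _)] at h1
      refine h1.trans ?_
      rw [← mul_assoc, mul_two]
      exact mul_le_mul_left ((hφ2 j).trans (add_le_add le_rfl (hsmall j))) _
    refine ne_top_of_le_ne_top ?_ (ENNReal.tsum_le_tsum hle)
    rw [ENNReal.tsum_mul_right]
    exact ENNReal.mul_ne_top hεsum (ENNReal.mul_ne_top ENNReal.ofNat_ne_top hCt)
  have hφ0 := ae_tendsto_zero_of_summable_grad g hbd hφ hgradsum
  have hmeas : TendstoInMeasure (riemVolume g)
      (fun j => φ j - fun x => S (trunc (h j) (u x) - trunc (h j) (t x))) atTop 0 := by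
    refine tendstoInMeasure_of_tendsto_eLpNorm hp0 (fun j => ?_) aestronglyMeasurable_zero ?_
    · exact (hφ j).measurable.aestronglyMeasurable.sub
        (hS.continuous.measurable.comp_aemeasurable
          ((hu.aemeasurable_trunc _).sub (ht.aemeasurable_trunc _))).aestronglyMeasurable
    · simp only [sub_zero]
      exact tendsto_of_tendsto_of_tendsto_of_le_of_le tendsto_const_nhds
        (ENNReal.tendsto_atTop_zero_of_tsum_ne_top hεsum) (fun _ => zero_le) hφ1
  obtain ⟨ns, hns, hae⟩ := hmeas.exists_seq_tendsto_ae
  filter_upwards [hφ0, hae] with x hx1 hx2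
  have h1 := (hx1.comp hns.tendsto_atTop).sub hx2
  have hhlim : Tendsto (fun i => h (ns i)) atTop atTop :=
    tendsto_atTop_mono (fun i => hj (ns i)) (tendsto_natCast_atTop_atTop.comp hns.tendsto_atTop)
  have h2 : Tendsto (fun _ : ℕ => S (u x - t x)) atTop (𝓝 0) := by
    rw [Pi.zero_apply, sub_zero] at h1
    refine h1.congr' ?_
    filter_upwards [hhlim.eventually (eventually_trunc_eq (u x)),
      hhlim.eventually (eventually_trunc_eq (t x))] with i hi1 hi2
    simp only [Function.comp_apply, Pi.sub_apply, hi1, hi2]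
    ring
  exact sub_eq_zero.1 (hS0 _ (tendsto_nhds_unique tendsto_const_nhds h2))

end Uniqueness

theorem theorem10 {n : ℕ} [NeZero n] {M : Type*} [TopologicalSpace M] [T2Space M] [CompactSpace M]
    [ChartedSpace (EuclideanHalfSpace n) M] [IsManifold (𝓡∂ n) ∞ M]
    [MeasurableSpace M] [BorelSpace M]
    (g : SmoothMetric n M)
    (hbd : ∀ x : M, ∃ y ∈ (𝓡∂ n).boundary M, y ∈ connectedComponent x)
    (p : ℝ) (hp : 1 < p)
    (f : M → ℝ) (hf : Integrable f (riemVolume g))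
    (u₁ u₂ : M → ℝ)
    (h₁ : IsEntropySolution g p f u₁) (h₂ : IsEntropySolution g p f u₂) :
    u₁ =ᵐ[riemVolume g] u₂ := by
  obtain ⟨hu₁, V₁, hV₁, H₁⟩ := h₁
  obtain ⟨hu₂, V₂, hV₂, H₂⟩ := h₂
  exact EntropyFormulation.ae_eq hbd hp H₁ H₂ hf hu₁ hV₁ hu₂ hV₂
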